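/- For non-negative integers $r,s,t$ let $\mathbb C^{r,s,t}$ be $\mathbb C^{r+s+t}$ with the (possibly degenerate) Hermitian form $\langle z,w\rangle_{r,s,t}=\sum_{i=1}^{r}z_i\bar w_i-\sum_{i=r+1}^{r+s}z_i\bar w_i$, let $\mathbb P^{r,s,t}$ be its projectivization, and write $p\perp q$ for orthogonality with respect to this form. Write $\mathbb P^{r,s}=\mathbb P^{r,s,0}$. Let $U\subset\mathbb P^{r,s,t}$ be open. A pair $(\phi,\psi)$ of holomorphic maps $U\to\mathbb P^{r',s',t'}$ is an orthogonal pair if $\phi(p)\perp\psi(q)$ for all $p,q\in U$ with $p\perp q$; it is null if $\phi(p)\perp\psi(q)$ for all $p,q\in U$. A pair of (possibly only densely defined) maps on $U$ is standard if it is induced by linear maps $\Phi,\Psi:\mathbb C^{r,s,t}\to\mathbb C^{r',s',t'}$ such that, for some real $\lambda\neq0$, $\langle\Phi(z),\Psi(w)\rangle_{r',s',t'}=\lambda\langle z,w\rangle_{r,s,t}$ for all $z,w$. The pair $(\phi,\psi)$ is quasi-standard if there is an orthogonal decomposition $\mathbb C^{r',s',t'}=V\oplus W$, with induced (partially defined)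 projections $\pi^V,\pi^W$ to $\mathbb PV,\mathbb PW$, such that $(\pi^V\circ\phi,\pi^V\circ\psi)$ is standard and, moreover, either the image of $\phi$ or the image of $\psi$ is contained in $\mathbb PV$, or $(\pi^W\circ\phi,\pi^W\circ\psi)$ is null, i.e. $\pi^W\phi(p)\perp\pi^W\psi(q)$ for all $p,q\in U$ at which these projections are defined. **Theorem.** Let $r,s,t,n'$ be non-negative integers with $n'\le 2(r+s)-3$. Let $U\subset\mathbb P^{r,s,t}$ be a connected open set which contains two (possibly equal) points $p,q$ with $p\perp q$. Then every orthogonal pair $(\phi,\psi)$ of holomorphic maps from $U$ to $\mathbb P^{n',0}$ is quasi-standard or null. -/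

import Mathlib

open scoped LinearAlgebra.Projectivization Topology ComplexConjugate

namespace OrthogonalPair

/-- The coordinate space of `ℂ^{r,s,t}`. -/
abbrev CSpace (r s t : ℕ) : Type := Fin (r + s + t) → ℂ

/-- The projective space `ℙ^{r,s,t}`, the set of complex lines in `ℂ^{r,s,t}`. -/
abbrev PSpace (r s t : ℕ) : Type := ℙ ℂ (CSpace r s t)

/-- The quotient topology on the projective space of `ℂ^n`. -/
noncomputable instance instTopologicalSpaceProjectivization (n : ℕ) :
    TopologicalSpace (ℙ ℂ (Fin n → ℂ)) :=
  TopologicalSpace.coinduced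
    (fun v : {v : Fin n → ℂ // v ≠ 0} => Projectivization.mk' ℂ v) inferInstance

/-- The diagonal entries of the form: `+1` (`r` times), `-1` (`s` times), `0` (`t` times). -/
def sgn (r s t : ℕ) (i : Fin (r + s + t)) : ℂ :=
  if (i : ℕ) < r then 1 else if (i : ℕ) < r + s then -1 else 0

/-- The Hermitian form
`⟨z,w⟩_{r,s,t} = ∑_{i ≤ r} zᵢ w̄ᵢ - ∑_{r < i ≤ r+s} zᵢ w̄ᵢ`. -/
noncomputable def herm (r s t : ℕ) (z w : CSpace r s t) : ℂ :=
  ∑ i, sgn r s t i * z i * conj (w i)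

/-- Orthogonality of two linear subspaces of `ℂ^{r,s,t}`. -/
def PerpSub (r s t : ℕ) (L M : Submodule ℂ (CSpace r s t)) : Prop :=
  ∀ z ∈ L, ∀ w ∈ M, herm r s t z w = 0

/-- Orthogonality `p ⊥ q` of two points of `ℙ^{r,s,t}`. -/
def Perp (r s t : ℕ) (p q : PSpace r s t) : Prop :=
  PerpSub r s t p.submodule q.submodule

/-- `φ` is holomorphic on `U`: around each nonzero vector `v` with `[v] ∈ U` it has a
nowhere vanishing holomorphic lift. -/
def HolomorphicOn {m n : ℕ} (U : Set (ℙ ℂ (Fin m → ℂ)))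
    (φ : ℙ ℂ (Fin m → ℂ) → ℙ ℂ (Fin n → ℂ)) : Prop :=
  ∀ (v : Fin m → ℂ) (hv : v ≠ 0), Projectivization.mk ℂ v hv ∈ U →
    ∃ (N : Set (Fin m → ℂ)) (f : (Fin m → ℂ) → (Fin n → ℂ)),
      IsOpen N ∧ v ∈ N ∧ DifferentiableOn ℂ f N ∧
      ∀ w ∈ N, ∀ hw : w ≠ 0, ∃ hf : f w ≠ 0,
        φ (Projectivization.mk ℂ w hw) = Projectivization.mk ℂ (f w) hf

/-- `(φ, ψ)` is an orthogonal pair on the open set `U ⊆ ℙ^{r,s,t}` with values in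
`ℙ^{r',s',t'}`. The values of `φ`, `ψ` outside `U` play no role. -/
structure IsOrthogonalPair (r s t r' s' t' : ℕ) (U : Set (PSpace r s t))
    (φ ψ : PSpace r s t → PSpace r' s' t') : Prop where
  isOpen : IsOpen U
  holomorphic_left : HolomorphicOn U φ
  holomorphic_right : HolomorphicOn U ψ
  perp : ∀ p ∈ U, ∀ q ∈ U, Perp r s t p q → Perp r' s' t' (φ p) (ψ q)

/-- A partially defined map into a projective space is a map whose values are linear
subspaces of dimension at most one; the value `⊥` means that the map is not defined at the point.
`lineMap φ` is an everywhere defined map in this form. -/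
noncomputable def lineMap {X : Type*} {n : ℕ} (φ : X → ℙ ℂ (Fin n → ℂ)) (p : X) :
    Submodule ℂ (Fin n → ℂ) :=
  (φ p).submodule

/-- The composition of a map into a projective space with the map of projective spaces induced
by a linear map `T`; it is undefined where the line is killed by `T`. -/
def compLinear {X : Type*} {n k : ℕ} (T : (Fin n → ℂ) →ₗ[ℂ] (Fin k → ℂ))
    (f : X → Submodule ℂ (Fin n → ℂ)) (p : X) : Submodule ℂ (Fin k → ℂ) :=
  (f p).map T

/-- The partially defined map of projective spaces induced by a linear map `Φ`. -/
noncomputable def ofLinear {m n : ℕ} (Φ : (Fin m → ℂ) →ₗ[ℂ] (Fin n → ℂ)) :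
    ℙ ℂ (Fin m → ℂ) → Submodule ℂ (Fin n → ℂ) :=
  compLinear Φ (lineMap id)

/-- Equality on `U` of partially defined maps into projective space: both are defined on a common
dense subset of `U`, and they agree wherever both are defined. -/
def RatEqOn {X : Type*} [TopologicalSpace X] {n : ℕ} (U : Set X)
    (f g : X → Submodule ℂ (Fin n → ℂ)) : Prop :=
  U ⊆ closure {p | p ∈ U ∧ f p ≠ ⊥ ∧ g p ≠ ⊥} ∧
  ∀ p ∈ U, f p ≠ ⊥ → g p ≠ ⊥ → f p = g p

/-- `(Φ, Ψ)` is a linear conformal pair from `ℂ^{r,s,t}` to `ℂ^{r',s',t'}`. -/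
def IsConformalPair (r s t r' s' t' : ℕ) (Φ Ψ : CSpace r s t →ₗ[ℂ] CSpace r' s' t') : Prop :=
  ∃ c : ℝ, c ≠ 0 ∧ ∀ z w, herm r' s' t' (Φ z) (Ψ w) = (c : ℂ) * herm r s t z w

/-- A standard pair (of partially defined maps) on `U`: induced by a linear conformal pair. -/
def IsStandard (r s t r' s' t' : ℕ) (U : Set (PSpace r s t))
    (f g : PSpace r s t → Submodule ℂ (CSpace r' s' t')) : Prop :=
  ∃ Φ Ψ : CSpace r s t →ₗ[ℂ] CSpace r' s' t', IsConformalPair r s t r' s' t' Φ Ψ ∧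
    RatEqOn U f (ofLinear Φ) ∧ RatEqOn U g (ofLinear Ψ)

/-- A null pair (of partially defined maps) on `U`: `f p ⊥ g q` for all `p`, `q` in `U` at which
the respective map is defined. (Where `f p = ⊥` or `g q = ⊥` the condition is empty.) -/
def IsNull (r s t r' s' t' : ℕ) (U : Set (PSpace r s t))
    (f g : PSpace r s t → Submodule ℂ (CSpace r' s' t')) : Prop :=
  ∀ p ∈ U, ∀ q ∈ U, PerpSub r' s' t' (f p) (g q)

/-- The pair `(φ, ψ)` is null on `U`. -/
def IsNullPair (r s t r' s' t' : ℕ) (U : Set (PSpace r s t))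
    (φ ψ : PSpace r s t → PSpace r' s' t') : Prop :=
  IsNull r s t r' s' t' U (lineMap φ) (lineMap ψ)

/-- The pair `(φ, ψ)` is quasi-standard on `U`. For an orthogonal decomposition
`ℂ^{r',s',t'} = V ⊕ W`, the linear maps inducing `π^V` and `π^W` are the projection onto `V`
along `W` and the projection onto `W` along `V`. -/
def IsQuasiStandard (r s t r' s' t' : ℕ) (U : Set (PSpace r s t))
    (φ ψ : PSpace r s t → PSpace r' s' t') : Prop :=
  ∃ (V W : Submodule ℂ (CSpace r' s' t')) (h : IsCompl V W),
    PerpSub r' s' t' V W ∧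
    IsStandard r s t r' s' t' U
      (compLinear (V.projection W h) (lineMap φ)) (compLinear (V.projection W h) (lineMap ψ)) ∧
    (((∀ p ∈ U, lineMap φ p ≤ V) ∨ (∀ p ∈ U, lineMap ψ p ≤ V)) ∨
      IsNull r s t r' s' t' U
        (compLinear (W.projection V h.symm) (lineMap φ)) (compLinear (W.projection V h.symm) (lineMap ψ)))

end OrthogonalPair

/-! After conjugation of the second variable the pair becomes holomorphic data: `F` lifts `φ`, `G`
lifts `ψ` as functionals, and `G w (F z) = 0` whenever `B z w = 0`. For a pair that is not null, the
core is the local factorization `G w (F z) = a z * b w * B z w` (`LocalPair.exists_factorization`).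

Put `k = r + s - 1`, cut the source by `k` generic hyperplanes, and let `α j` be the dimension of
the span of `F` over the `j`-th section. Non-nullity gives `α 1 < α 0`, nonvanishing of `F` gives `1
≤ α k`, and `α 0 ≤ 2 * k - 1`; so some drop after the first is at most one. By `Generic.drop_le_one`
a small drop forces the preceding drop to be small, hence the first two drops are at most one.

A drop of at most one says that functionals vanishing over a section are proportional over the
section before it. Applied to `G w₀` and `G (w₀ + ε v)` on the members of a pencil, this makes the
quotients of `G w ∘ F` by `B · w` at these two points proportional (`exists_pencil_ratio`), unless
`G w₀ ∘ F` vanishes to second order along the axis of the pencil. If that happens for an open family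
of axes, `w₀` is stationary (`Generic.stationary`), and non-nullity provides a `w₀` that is not.

Globally, let `P`, `Q` be the spans of the values of `φ`, `ψ` and let `W` be the sum of `P ∩ Q^⊥`
and `Q ∩ P^⊥`. Projection to `W^⊥` preserves the pairing of `P` with `Q` and makes it nondegenerate,
so the factorization forces the projected maps to be linear up to scalars, while the `W`-components
are mutually orthogonal. The identity theorem on the connected set `U` carries local identities to
all of `U`. -/

namespace OrthogonalPair

/-! ### Preliminaries: identity theorem, linear algebra, semicontinuity -/

section Holomorphic

variable {Z : Type*} [NormedAddCommGroup Z] [NormedSpace ℂ Z]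

/-- The identity theorem on the trace of a convex open set on a linear subspace. -/
theorem eq_zero_of_eventually_eq_zero_on_subspace {X : Set Z} (hXo : IsOpen X) (hXc : Convex ℝ X)
    {f : Z → ℂ} (hf : DifferentiableOn ℂ f X) (Λ : Submodule ℂ Z) {y : Z} (hyX : y ∈ X)
    (hyΛ : y ∈ Λ) (hy : ∀ᶠ x in 𝓝 y, x ∈ Λ → f x = 0) {z : Z} (hz : z ∈ X) (hzΛ : z ∈ Λ) :
    f z = 0 := by
  -- The complex line through `y` and `z` lies in `Λ` and meets `X` in a convex, hence connected,
  -- set, so the one-variable identity theorem suffices.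
  let c : ℂ → Z := fun s => y + s • (z - y)
  have hcd : Differentiable ℂ c := by fun_prop
  have hco : IsOpen (c ⁻¹' X) := hXo.preimage hcd.continuous
  have hcc : Convex ℝ (c ⁻¹' X) := by
    intro a ha b hb p q hp hq hpq
    have : c (p • a + q • b) = p • c a + q • c b := by
      have e : p • y + q • y = y := by rw [← add_smul, hpq, one_smul]
      calc y + (p • a + q • b) • (z - y)
          = (p • y + q • y) + (p • (a • (z - y)) + q • (b • (z - y))) := by
            rw [e, add_smul, smul_assoc, smul_assoc]
        _ = _ := by simp only [c, smul_add]; abel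
    change c _ ∈ X
    rw [this]
    exact hXc ha hb hp hq hpq
  have h0 : (0 : ℂ) ∈ c ⁻¹' X := by simpa [c] using hyX
  have h1 : (1 : ℂ) ∈ c ⁻¹' X := by simpa [c] using hz
  have han : AnalyticOnNhd ℂ (f ∘ c) (c ⁻¹' X) :=
    (hf.comp hcd.differentiableOn (fun _ h => h)).analyticOnNhd hco
  have hev : (f ∘ c) =ᶠ[𝓝 0] 0 := by
    have : Filter.Tendsto c (𝓝 0) (𝓝 y) := by
      have := hcd.continuous.tendsto 0
      simpa [c] using this
    filter_upwards [this.eventually hy] with s hs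
    exact hs (Λ.add_mem hyΛ (Λ.smul_mem _ (Λ.sub_mem hzΛ hyΛ)))
  have := han.eqOn_zero_of_preconnected_of_eventuallyEq_zero hcc.isPreconnected h0 hev h1
  simpa [c] using this

end Holomorphic

section LinearAlgebra

variable {Z : Type*} [AddCommGroup Z] [Module ℂ Z]

/-- A proper range lies in the kernel of a nonzero functional on `Fin k → ℂ`, whose coefficients
form a linear relation among the `ℓ i`. -/
theorem surjective_pi_of_linearIndependent {k : ℕ} {ℓ : Fin k → Module.Dual ℂ Z}
    (h : LinearIndependent ℂ ℓ) : Function.Surjective (LinearMap.pi ℓ) := by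
  rw [← LinearMap.range_eq_top]
  by_contra hne
  obtain ⟨g, hg0, hg⟩ := Submodule.exists_le_ker_of_lt_top _ (lt_top_iff_ne_top.2 hne)
  refine hg0 ?_
  have hc : ∀ c : Fin k → ℂ, g c = ∑ i, c i * g (Pi.single i 1) := fun c => by
    conv_lhs => rw [pi_eq_sum_univ' c]
    simp
  have h1 : ∑ i, g (Pi.single i 1) • ℓ i = 0 := by
    ext z
    have : g (LinearMap.pi ℓ z) = 0 := hg ⟨z, rfl⟩
    rw [hc] at this
    simpa [mul_comm] using this
  have h2 := Fintype.linearIndependent_iff.1 h _ h1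
  ext i
  simpa using h2 i

theorem exists_eq_mul_of_ker_le {M : Type*} [AddCommGroup M] [Module ℂ M] (f g : M →ₗ[ℂ] ℂ)
    (h : ∀ x, f x = 0 → g x = 0) : ∃ c : ℂ, ∀ x, g x = c * f x := by
  by_cases hf : ∀ x, f x = 0
  · exact ⟨0, fun x => by simp [h x (hf x)]⟩
  push Not at hf
  obtain ⟨y, hy⟩ := hf
  refine ⟨g y / f y, fun x => ?_⟩
  have := h (x - (f x / f y) • y) (by simp [hy])
  simp only [map_sub, map_smul, smul_eq_mul] at this
  rw [sub_eq_zero.1 this]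
  ring

/-- If `T ≤ S` has codimension at most one, two functionals vanishing on `T` are proportional
on `S`. -/
theorem exists_combination_eq_zero_on [FiniteDimensional ℂ Z] {S T : Submodule ℂ Z} (hTS : T ≤ S)
    (hd : Module.finrank ℂ S ≤ Module.finrank ℂ T + 1) (a b : Module.Dual ℂ Z)
    (ha : ∀ x ∈ T, a x = 0) (hb : ∀ x ∈ T, b x = 0) :
    ∃ c d : ℂ, (c ≠ 0 ∨ d ≠ 0) ∧ ∀ x ∈ S, c * a x + d * b x = 0 := by
  by_cases h : ∀ x ∈ S, b x = 0
  · exact ⟨0, 1, Or.inr one_ne_zero, fun x hx => by simp [h x hx]⟩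
  push Not at h
  obtain ⟨s, hs, hbs⟩ := h
  refine ⟨b s, -a s, Or.inl hbs, ?_⟩
  have hsT : s ∉ T := fun h => hbs (hb s h)
  have hlt : T < T ⊔ Submodule.span ℂ {s} := by
    refine lt_of_le_of_ne le_sup_left fun h => hsT ?_
    rw [h]
    exact Submodule.mem_sup_right (Submodule.mem_span_singleton_self s)
  have hle : T ⊔ Submodule.span ℂ {s} ≤ S :=
    sup_le hTS ((Submodule.span_singleton_le_iff_mem _ _).2 hs)
  have heq : T ⊔ Submodule.span ℂ {s} = S :=
    Submodule.eq_of_le_of_finrank_le hle (by have := Submodule.finrank_lt_finrank_of_lt hlt; omega)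
  intro x hx
  rw [← heq] at hx
  obtain ⟨t, ht, u, hu, rfl⟩ := Submodule.mem_sup.1 hx
  obtain ⟨c, rfl⟩ := Submodule.mem_span_singleton.1 hu
  simp [ha t ht, hb t ht]
  ring

/-- If `T ≤ S` has codimension at least two, there are two functionals vanishing on `T` which are
linearly independent on `S`. -/
theorem exists_functionals_independent_on [FiniteDimensional ℂ Z] {S T : Submodule ℂ Z}
    (hd : Module.finrank ℂ T + 2 ≤ Module.finrank ℂ S) :
    ∃ a b : Module.Dual ℂ Z, (∀ x ∈ T, a x = 0) ∧ (∀ x ∈ T, b x = 0) ∧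
      (∃ x ∈ S, b x ≠ 0) ∧ ∀ c : ℂ, ∃ x ∈ S, a x - c * b x ≠ 0 := by
  have key : ∀ R : Submodule ℂ Z, Module.finrank ℂ R < Module.finrank ℂ S →
      ∃ x ∈ S, ∃ b : Module.Dual ℂ Z, (∀ y ∈ R, b y = 0) ∧ b x ≠ 0 := by
    intro R hR
    obtain ⟨x, hxS, hxR⟩ : ∃ x ∈ S, x ∉ R := by
      by_contra! hcon
      exact absurd (Submodule.finrank_mono hcon) (not_le.2 hR)
    obtain ⟨b, hbx, hb⟩ := Submodule.exists_le_ker_of_notMem hxR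
    exact ⟨x, hxS, b, fun y hy => hb hy, hbx⟩
  obtain ⟨x, hxS, b, hb, hbx⟩ := key T (by omega)
  have h2 : Module.finrank ℂ ↥(T ⊔ Submodule.span ℂ {x}) ≤ Module.finrank ℂ T + 1 :=
    (Submodule.finrank_add_le_finrank_add_finrank _ _).trans
      (Nat.add_le_add_left (by simpa using finrank_span_le_card ({x} : Set Z)) _)
  -- Letting `a` also kill `x` makes the pair triangular: `x` detects `b` alone, which settles every
  -- `c ≠ 0`, and `y` settles `c = 0`.
  obtain ⟨y, hyS, a, ha, hay⟩ := key (T ⊔ Submodule.span ℂ {x}) (by omega)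
  have hax : a x = 0 := ha x (Submodule.mem_sup_right (Submodule.mem_span_singleton_self x))
  refine ⟨a, b, fun t ht => ha t (Submodule.mem_sup_left ht), hb, ⟨x, hxS, hbx⟩, fun c => ?_⟩
  by_cases hc : c = 0
  · exact ⟨y, hyS, by simpa [hc] using hay⟩
  · exact ⟨x, hxS, by simp [hax, hc, hbx]⟩

end LinearAlgebra

section Semicontinuity

/-- Finitely many lower semicontinuous bounded functions with values in `ℕ` are simultaneously
locally constant near some point of a given nonempty open set. -/
theorem exists_eventually_const_of_lsc {α : Type*} [TopologicalSpace α] {O : Set α}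
    (hO : IsOpen O) (hne : O.Nonempty) (m N : ℕ) (a : ℕ → α → ℕ) (hb : ∀ j x, a j x ≤ N)
    (hl : ∀ x ∈ O, ∀ j, ∀ᶠ y in 𝓝 x, a j x ≤ a j y) :
    ∃ x ∈ O, ∀ᶠ y in 𝓝 x, ∀ j ≤ m, a j y = a j x := by
  -- At a point where the sum is maximal, no summand can increase nearby; semicontinuity forbids a
  -- decrease.
  let σ : α → ℕ := fun x => ∑ j ∈ Finset.range (m + 1), a j x
  have hfin : (σ '' O).Finite := by
    refine (Set.finite_Iic ((m + 1) * N)).subset ?_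
    rintro _ ⟨x, -, rfl⟩
    have := Finset.sum_le_card_nsmul (Finset.range (m + 1)) (fun j => a j x) N (fun j _ => hb j x)
    simpa using this
  obtain ⟨_, ⟨x, hx, rfl⟩, hmax⟩ := hfin.exists_maximal (hne.image σ)
  refine ⟨x, hx, ?_⟩
  have h1 : ∀ᶠ y in 𝓝 x, ∀ j ∈ Finset.range (m + 1), a j x ≤ a j y :=
    (Finset.eventually_all _).2 fun j _ => hl x hx j
  filter_upwards [h1, hO.mem_nhds hx] with y hy hyO j hj
  have h2 : σ y ≤ σ x := by
    have := @hmax (σ y) ⟨y, hyO, rfl⟩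
    by_contra hlt
    exact hlt (this (Finset.sum_le_sum hy))
  have h3 : σ x = σ y := le_antisymm (Finset.sum_le_sum hy) h2
  exact ((Finset.sum_eq_sum_iff_of_le hy).1 h3 j (Finset.mem_range.2 (by omega))).symm

end Semicontinuity

/-! ### Local pairs, linear sections and generic tuples -/

/-- Local holomorphic data of an orthogonal pair: holomorphic maps `F` on `X` and `G` on `Y`, the
latter with values in functionals, such that `G w (F z) = 0` whenever `B z w = 0`, and such that
`G w (F z)` does not vanish identically on any product of open sets. -/
structure LocalPair (Z W E : Type*) [NormedAddCommGroup Z] [NormedSpace ℂ Z]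
    [NormedAddCommGroup W] [NormedSpace ℂ W] [NormedAddCommGroup E] [NormedSpace ℂ E] where
  B : Z →L[ℂ] W →L[ℂ] ℂ
  X : Set Z
  Y : Set W
  isOpen_X : IsOpen X
  convex_X : Convex ℝ X
  isOpen_Y : IsOpen Y
  F : Z → E
  G : W → E →L[ℂ] ℂ
  diff_F : DifferentiableOn ℂ F X
  diff_G : DifferentiableOn ℂ G Y
  F_ne : ∀ z ∈ X, F z ≠ 0
  orth : ∀ z ∈ X, ∀ w ∈ Y, B z w = 0 → G w (F z) = 0
  nonnull : ∀ X' ⊆ X, IsOpen X' → X'.Nonempty → ∀ Y' ⊆ Y, IsOpen Y' → Y'.Nonempty →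
    ∃ z ∈ X', ∃ w ∈ Y', G w (F z) ≠ 0

namespace LocalPair

variable {Z W E : Type*} [NormedAddCommGroup Z] [NormedSpace ℂ Z]
    [NormedAddCommGroup W] [NormedSpace ℂ W] [NormedAddCommGroup E] [NormedSpace ℂ E]
    (D : LocalPair Z W E) {k : ℕ}

/-- The common orthogonal complement of the first `j` vectors of a tuple. -/
def flat (w : Fin k → W) (j : ℕ) : Submodule ℂ Z where
  carrier := {z | ∀ i : Fin k, (i : ℕ) < j → D.B z (w i) = 0}
  add_mem' := fun {a b} ha hb i hi => by simp [ha i hi, hb i hi]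
  zero_mem' := fun i _ => by simp
  smul_mem' := fun c a ha i hi => by simp [ha i hi]

theorem mem_flat_succ {w : Fin k → W} (i : Fin k) {z : Z} :
    z ∈ D.flat w (i + 1) ↔ z ∈ D.flat w i ∧ D.B z (w i) = 0 := by
  refine ⟨fun h => ⟨fun l hl => h l (by omega), h i (by omega)⟩, fun h l hl => ?_⟩
  rcases Nat.lt_succ_iff_lt_or_eq.1 hl with h1 | h1
  · exact h.1 l h1
  · obtain rfl := Fin.ext h1
    exact h.2

theorem flat_anti (w : Fin k → W) : Antitone (D.flat w) :=
  fun _ _ hab _ hz i hi => hz i (hi.trans_le hab)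

/-- The span of the image under `F` of the trace of `flat w j`. -/
def sp (w : Fin k → W) (j : ℕ) : Submodule ℂ E :=
  Submodule.span ℂ (D.F '' (D.X ∩ D.flat w j))

theorem F_mem_sp {w : Fin k → W} {j : ℕ} {z : Z} (hz : z ∈ D.X) (h : z ∈ D.flat w j) :
    D.F z ∈ D.sp w j :=
  Submodule.subset_span ⟨z, ⟨hz, h⟩, rfl⟩

theorem sp_anti (w : Fin k → W) : Antitone (D.sp w) := fun _ _ hab =>
  Submodule.span_mono (Set.image_mono (Set.inter_subset_inter_right _ (D.flat_anti w hab)))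

theorem eq_zero_on_sp {w : Fin k → W} {j : ℕ} (l : E →ₗ[ℂ] ℂ)
    (h : ∀ z ∈ D.X, z ∈ D.flat w j → l (D.F z) = 0) {x : E} (hx : x ∈ D.sp w j) : l x = 0 := by
  have : D.sp w j ≤ LinearMap.ker l := by
    refine Submodule.span_le.2 ?_
    rintro _ ⟨z, hz, rfl⟩
    exact h z hz.1 hz.2
  exact this hx

/-- The tuples in `Y`, independent modulo the kernel of the form, whose orthogonal complement
meets `X`. -/
def dom (k : ℕ) : Set (Fin k → W) :=
  {w | (∀ i, w i ∈ D.Y) ∧ LinearIndependent ℂ (fun i => D.B.flip (w i)) ∧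
    ∃ z ∈ D.X, z ∈ D.flat w k}

theorem surjective_of_linearIndependent {w : Fin k → W}
    (h : LinearIndependent ℂ (fun i => D.B.flip (w i))) :
    Function.Surjective (ContinuousLinearMap.pi fun i => D.B.flip (w i)) := by
  have h' : LinearIndependent ℂ (fun i => ((D.B.flip (w i) : Z →L[ℂ] ℂ) : Module.Dual ℂ Z)) :=
    h.map' (ContinuousLinearMap.coeLM ℂ) (LinearMap.ker_eq_bot.2 ContinuousLinearMap.coe_injective)
  exact surjective_pi_of_linearIndependent h'

/-- Points of `flat w₀ j` can be moved continuously with the tuple. -/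
theorem exists_moving_projection {w₀ : Fin k → W}
    (h : LinearIndependent ℂ (fun i => D.B.flip (w₀ i))) (j : ℕ) :
    ∃ π : (Fin k → W) → Z → Z, (∀ x, ContinuousAt (fun w => π w x) w₀) ∧
      (∀ᶠ w in 𝓝 w₀, ∀ x, π w x ∈ D.flat w j) ∧ ∀ x ∈ D.flat w₀ j, π w₀ x = x := by
  let ℓ : (Fin k → W) → Z →L[ℂ] (Fin k → ℂ) := fun w =>
    ContinuousLinearMap.pi fun i => D.B.flip (w i)
  obtain ⟨R, hR⟩ := (ℓ w₀).exists_rightInverse_of_surjective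
    (LinearMap.range_eq_top.2 (D.surjective_of_linearIndependent h))
  have hℓ : Continuous ℓ := by
    have : ℓ = fun w => ∑ i : Fin k,
        (ContinuousLinearMap.single ℂ (fun _ : Fin k => ℂ) i) ∘L (D.B.flip (w i)) := by
      funext w
      ext z i
      simp [ℓ, Finset.sum_apply, Pi.single_apply]
    rw [this]
    fun_prop
  let M : (Fin k → W) → (Fin k → ℂ) →L[ℂ] (Fin k → ℂ) := fun w => ℓ w ∘L R
  have hM : Continuous M := by fun_prop
  have hM0 : M w₀ = 1 := hR
  have hu : ∀ᶠ w in 𝓝 w₀, IsUnit (M w) :=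
    hM.continuousAt.eventually (Units.isOpen.mem_nhds (by rw [hM0]; exact isUnit_one))
  have hinv : ContinuousAt (fun w => Ring.inverse (M w)) w₀ := by
    refine ContinuousAt.comp (g := Ring.inverse) (f := M) ?_ hM.continuousAt
    rw [hM0]
    exact NormedRing.inverse_continuousAt (1 : ((Fin k → ℂ) →L[ℂ] (Fin k → ℂ))ˣ)
  let trunc : (Fin k → ℂ) → (Fin k → ℂ) := fun c i => if (i : ℕ) < j then c i else 0
  have ht : Continuous trunc := by
    refine continuous_pi fun i => ?_
    by_cases hi : (i : ℕ) < j
    · simpa [trunc, hi] using continuous_apply i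
    · simpa [trunc, hi] using continuous_const
  -- Near `w₀`, `R` composed with the inverse of `M w` is a right inverse of `ℓ w`; the subtracted
  -- term cancels exactly the first `j` coordinates of `ℓ w x`.
  refine ⟨fun w x => x - R (Ring.inverse (M w) (trunc (ℓ w x))), fun x => ?_, ?_, fun x hx => ?_⟩
  · refine continuousAt_const.sub (R.continuous.continuousAt.comp ?_)
    refine hinv.clm_apply (ht.continuousAt.comp ?_)
    exact hℓ.continuousAt.clm_apply continuousAt_const
  · filter_upwards [hu] with w hw x i hi
    have h1 : ℓ w (R (Ring.inverse (M w) (trunc (ℓ w x)))) = trunc (ℓ w x) := by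
      have := Ring.mul_inverse_cancel _ hw
      exact DFunLike.congr_fun this (trunc (ℓ w x))
    have h2 := congrFun h1 i
    have h3 : D.B (R (Ring.inverse (M w) (trunc (ℓ w x)))) (w i) = D.B x (w i) := by
      simpa [ℓ, trunc, hi] using h2
    simp [h3]
  · have : trunc (ℓ w₀ x) = 0 := by
      funext i
      by_cases hi : (i : ℕ) < j
      · simpa [trunc, hi, ℓ] using hx i hi
      · simp [trunc, hi]
    simp [this]

theorem isOpen_dom : IsOpen (D.dom k) := by
  rw [isOpen_iff_eventually]
  rintro w ⟨hY, hl, z, hzX, hz⟩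
  obtain ⟨π, hc, hmem, hfix⟩ := D.exists_moving_projection hl k
  have h1 : ∀ᶠ w' in 𝓝 w, ∀ i, w' i ∈ D.Y := Filter.eventually_all.2 fun i =>
    (continuous_apply i).continuousAt.eventually (D.isOpen_Y.mem_nhds (hY i))
  have h2 : ∀ᶠ w' in 𝓝 w, LinearIndependent ℂ (fun i => D.B.flip (w' i)) := by
    have : Continuous fun (w' : Fin k → W) i => D.B.flip (w' i) := by fun_prop
    exact this.continuousAt.eventually (hl.eventually)
  have h3 : ∀ᶠ w' in 𝓝 w, π w' z ∈ D.X :=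
    (hc z).eventually (D.isOpen_X.mem_nhds (by simpa [hfix z hz] using hzX))
  filter_upwards [h1, h2, h3, hmem] with w' a b c d
  exact ⟨a, b, _, c, d z⟩

/-- `w` lies in the interior of the set of admissible tuples with prescribed dimensions `α`. -/
def Generic (α : ℕ → ℕ) (w : Fin k → W) : Prop :=
  ∀ᶠ w' in 𝓝 w, w' ∈ D.dom k ∧ ∀ j ≤ k, Module.finrank ℂ (D.sp w' j) = α j

theorem Generic.eventually {D : LocalPair Z W E} {α : ℕ → ℕ} {w : Fin k → W}
    (h : D.Generic α w) : ∀ᶠ w' in 𝓝 w, D.Generic α w' :=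
  eventually_eventually_nhds.2 h

variable [FiniteDimensional ℂ E]

/-- A basis of the span at `w₀` consists of vectors `F (x i)`. Moving the `x i` continuously into
the neighbouring sections keeps these vectors independent. -/
theorem finrank_sp_lsc {w₀ : Fin k → W} (hw : w₀ ∈ D.dom k) (j : ℕ) :
    ∀ᶠ w in 𝓝 w₀, Module.finrank ℂ (D.sp w₀ j) ≤ Module.finrank ℂ (D.sp w j) := by
  obtain ⟨π, hc, hmem, hfix⟩ := D.exists_moving_projection hw.2.1 j
  obtain ⟨f, hf, -, hli⟩ :=
    Submodule.exists_fun_fin_finrank_span_eq ℂ (D.F '' (D.X ∩ D.flat w₀ j))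
  choose x hx hxf using hf
  have hcont : ContinuousAt (fun w i => D.F (π w (x i))) w₀ := by
    refine continuousAt_pi.2 fun i => ContinuousAt.comp (g := D.F) ?_ (hc (x i))
    rw [hfix _ (hx i).2]
    exact (D.diff_F.differentiableAt (D.isOpen_X.mem_nhds (hx i).1)).continuousAt
  have h1 : ∀ᶠ w in 𝓝 w₀, LinearIndependent ℂ (fun i => D.F (π w (x i))) := by
    refine hcont.eventually (LinearIndependent.eventually ?_)
    have : (fun i => D.F (π w₀ (x i))) = f := by
      funext i
      rw [hfix _ (hx i).2, hxf]
    change LinearIndependent ℂ (fun i => D.F (π w₀ (x i)))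
    rw [this]
    exact hli
  have h2 : ∀ᶠ w in 𝓝 w₀, ∀ i, π w (x i) ∈ D.X := Filter.eventually_all.2 fun i =>
    (hc (x i)).eventually (D.isOpen_X.mem_nhds (by simpa [hfix _ (hx i).2] using (hx i).1))
  filter_upwards [h1, h2, hmem] with w hw1 hw2 hw3
  have hle : Submodule.span ℂ (Set.range fun i => D.F (π w (x i))) ≤ D.sp w j := by
    refine Submodule.span_mono ?_
    rintro _ ⟨i, rfl⟩
    exact ⟨_, ⟨hw2 i, hw3 _⟩, rfl⟩
  have := Submodule.finrank_mono hle
  rw [finrank_span_eq_card hw1, Fintype.card_fin] at this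
  exact this

theorem exists_generic (hne : (D.dom k).Nonempty) :
    ∃ (α : ℕ → ℕ) (w : Fin k → W), D.Generic α w := by
  obtain ⟨w, hw, h⟩ := exists_eventually_const_of_lsc D.isOpen_dom hne k (Module.finrank ℂ E)
    (fun j w => Module.finrank ℂ (D.sp w j)) (fun j w => Submodule.finrank_le _)
    (fun w hw j => D.finrank_sp_lsc hw j)
  have h' : ∀ᶠ w' in 𝓝 w, w' ∈ D.dom k := D.isOpen_dom.mem_nhds hw
  exact ⟨_, w, h'.and h⟩

end LocalPair
-- Sweeping by hyperplanes, pencils, and propagation of small drops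
namespace LocalPair

variable {Z W E : Type*} [NormedAddCommGroup Z] [NormedSpace ℂ Z]
    [NormedAddCommGroup W] [NormedSpace ℂ W] [NormedAddCommGroup E] [NormedSpace ℂ E]
    (D : LocalPair Z W E) {k : ℕ}

/-- A holomorphic function on `X ∩ Λ` vanishes if it vanishes on the hyperplane sections
of `Λ` by an open family of hyperplanes, restricted to those containing a given point `x₀`. -/
theorem eq_zero_of_sweep {Λ Λ' : Submodule ℂ Z} (hΛ : Λ' ≤ Λ) {c v₀ : W} {τ : ℂ} (hτ : τ ≠ 0)
    {V : Set W} (hV : V ∈ 𝓝 v₀) (hc : ∀ z ∈ Λ', D.B z (c + τ • v₀) = 0) {y₀ : Z} (hy₀ : y₀ ∈ D.X)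
    (hy₀' : y₀ ∈ Λ') {x₀ : Z} (hx₀ : D.B x₀ (c + τ • v₀) = 0)
    (ht : ∃ u ∈ Λ', ∃ δ, D.B x₀ δ = 0 ∧ D.B u δ ≠ 0) {f : Z → ℂ}
    (hf : DifferentiableOn ℂ f D.X)
    (h0 : ∀ z ∈ D.X, z ∈ Λ → ∀ v ∈ V, D.B x₀ (c + τ • v) = 0 → D.B z (c + τ • v) = 0 → f z = 0)
    {z : Z} (hz : z ∈ D.X) (hzΛ : z ∈ Λ) : f z = 0 := by
  obtain ⟨u, hu, δ, hδ, huδ⟩ := ht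
  -- The base point is moved inside `Λ'` to make `B y δ ≠ 0`, so that turning the hyperplane in the
  -- direction `δ` reaches every point near `y`.
  obtain ⟨η, hη, hyδ⟩ : ∃ η : ℂ, y₀ + η • u ∈ D.X ∧ D.B (y₀ + η • u) δ ≠ 0 := by
    have hcont : Continuous fun η : ℂ => y₀ + η • u := by fun_prop
    have h1 : ∀ᶠ η in 𝓝 (0 : ℂ), y₀ + η • u ∈ D.X :=
      hcont.continuousAt.eventually (D.isOpen_X.mem_nhds (by simpa using hy₀))
    by_cases hy : D.B y₀ δ = 0
    · obtain ⟨η, h, h'⟩ := ((h1.filter_mono nhdsWithin_le_nhds).and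
        (self_mem_nhdsWithin : ∀ᶠ η in 𝓝[≠] (0 : ℂ), η ∈ ({0}ᶜ : Set ℂ))).exists
      exact ⟨η, h, by simpa [hy, huδ] using h'⟩
    · exact ⟨0, by simpa using hy₀, by simpa using hy⟩
  set y := y₀ + η • u with hy
  have hyΛ' : y ∈ Λ' := Λ'.add_mem hy₀' (Λ'.smul_mem _ hu)
  refine eq_zero_of_eventually_eq_zero_on_subspace D.isOpen_X D.convex_X hf Λ hη (hΛ hyΛ') ?_ hz hzΛ
  -- Solves `B y' (c + τ • v y') = 0`; since `B x₀ δ = 0`, the turned hyperplane still contains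
  -- `x₀`.
  let v : Z → W := fun y' => v₀ - (D.B y' (c + τ • v₀) / (τ * D.B y' δ)) • δ
  have hBc : ∀ x : W, Continuous fun y' => D.B y' x := fun x => (D.B.flip x).continuous
  have hvc : ContinuousAt v y := by
    refine continuousAt_const.sub (ContinuousAt.smul ?_ continuousAt_const)
    exact (hBc _).continuousAt.div (continuousAt_const.mul (hBc _).continuousAt)
      (mul_ne_zero hτ hyδ)
  have hvy : v y = v₀ := by simp only [v, hc y hyΛ', zero_div, zero_smul, sub_zero]
  filter_upwards [hvc.eventually (by rw [hvy]; exact hV : ∀ᶠ x in 𝓝 (v y), x ∈ V),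
    D.isOpen_X.mem_nhds hη, (hBc δ).continuousAt.eventually_ne hyδ] with y' h1 h2 h3 h4
  refine h0 y' h2 h4 (v y') h1 ?_ ?_
  · simp only [map_add, map_smul, smul_eq_mul] at hx₀
    simp [v, hδ, hx₀]
  · simp only [v, map_add, map_smul, smul_eq_mul, map_sub]
    field_simp
    ring

theorem finrank_le_finrank_flat_add [FiniteDimensional ℂ Z] (w : Fin k → W) {j : ℕ} (hj : j ≤ k) :
    Module.finrank ℂ Z ≤ Module.finrank ℂ (D.flat w j) + j := by
  let L : Z →ₗ[ℂ] (Fin j → ℂ) :=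
    LinearMap.pi fun i => (D.B.flip (w (Fin.castLE hj i)) : Z →ₗ[ℂ] ℂ)
  have hL : LinearMap.ker L ≤ D.flat w j := by
    intro z hz i hi
    have := congrFun (LinearMap.mem_ker.1 hz) ⟨i, hi⟩
    simpa [L] using this
  have h1 := Submodule.finrank_mono hL
  have h2 := LinearMap.finrank_range_add_finrank_ker L
  have h3 := Submodule.finrank_le (LinearMap.range L)
  rw [Module.finrank_fin_fun] at h3
  omega

/-- Otherwise `B u` is a multiple of `B x₀` for every `u` in the section, which then lies in the
kernel of `B` plus a line; its codimension, at most `j < k`, is too small for that. -/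
theorem exists_transverse [FiniteDimensional ℂ Z]
    (hker : Module.finrank ℂ (LinearMap.ker (D.B : Z →ₗ[ℂ] W →L[ℂ] ℂ)) + (k + 1) ≤
      Module.finrank ℂ Z) (w : Fin k → W) {j : ℕ} (hj : j < k) (x₀ : Z) :
    ∃ u ∈ D.flat w j, ∃ δ, D.B x₀ δ = 0 ∧ D.B u δ ≠ 0 := by
  by_contra! hcon
  have hle : D.flat w j ≤ LinearMap.ker (D.B : Z →ₗ[ℂ] W →L[ℂ] ℂ) ⊔ Submodule.span ℂ {x₀} := by
    intro u hu
    obtain ⟨c, hc⟩ : ∃ c : ℂ, ∀ δ, D.B u δ = c * D.B x₀ δ :=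
      exists_eq_mul_of_ker_le (D.B x₀ : W →ₗ[ℂ] ℂ) (D.B u : W →ₗ[ℂ] ℂ) (hcon u hu)
    refine Submodule.mem_sup.2 ⟨u - c • x₀, ?_, c • x₀,
      Submodule.smul_mem _ _ (Submodule.mem_span_singleton_self x₀), by abel⟩
    rw [LinearMap.mem_ker]
    ext δ
    simp [hc δ]
  have h1 := Submodule.finrank_mono hle
  have h2 := Submodule.finrank_add_le_finrank_add_finrank
    (LinearMap.ker (D.B : Z →ₗ[ℂ] W →L[ℂ] ℂ)) (Submodule.span ℂ {x₀})
  have h3 : Module.finrank ℂ (Submodule.span ℂ {x₀}) ≤ 1 := by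
    simpa using finrank_span_le_card (R := ℂ) ({x₀} : Set Z)
  have h4 := D.finrank_le_finrank_flat_add w hj.le
  omega

theorem exists_B_ne_zero [FiniteDimensional ℂ Z]
    (hker : Module.finrank ℂ (LinearMap.ker (D.B : Z →ₗ[ℂ] W →L[ℂ] ℂ)) + (k + 1) ≤
      Module.finrank ℂ Z) (w : Fin k → W) {j : ℕ} (hj : j ≤ k) :
    ∃ u ∈ D.flat w j, ∃ δ, D.B u δ ≠ 0 := by
  by_contra! hcon
  have hle : D.flat w j ≤ LinearMap.ker (D.B : Z →ₗ[ℂ] W →L[ℂ] ℂ) := fun u hu =>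
    LinearMap.mem_ker.2 (ContinuousLinearMap.ext (hcon u hu))
  have h1 := Submodule.finrank_mono hle
  have h4 := D.finrank_le_finrank_flat_add w hj
  omega

/-- The tuple with two consecutive entries `wᵢ, wᵢ₊₁` replaced by `wᵢ + τ v, v`. -/
def pencil (w : Fin k → W) (i₀ i₁ : Fin k) (τ : ℂ) (v : W) : Fin k → W :=
  Function.update (Function.update w i₀ (w i₀ + τ • v)) i₁ v

section Pencil

variable {w : Fin k → W} {i₀ i₁ : Fin k}

theorem pencil_right (τ : ℂ) (v : W) : pencil w i₀ i₁ τ v i₁ = v := by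
  simp [pencil]

theorem Generic.exists_pencil (i₀ i₁ : Fin k) {α : ℕ → ℕ} (hw : D.Generic α w) :
    ∃ r > 0, ∃ V ∈ 𝓝 (w i₁), ∀ τ : ℂ, ‖τ‖ < r → ∀ v ∈ V, D.Generic α (pencil w i₀ i₁ τ v) := by
  have hc : Continuous fun p : ℂ × W => pencil w i₀ i₁ p.1 p.2 := by
    unfold pencil
    fun_prop
  have h0 : pencil w i₀ i₁ 0 (w i₁) = w := by simp [pencil]
  have h1 : ∀ᶠ p in 𝓝 ((0 : ℂ), w i₁), D.Generic α (pencil w i₀ i₁ p.1 p.2) := by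
    refine hc.continuousAt.eventually ?_
    simp only [h0]
    exact hw.eventually
  rw [nhds_prod_eq] at h1
  obtain ⟨p, hp, q, hq, hpq⟩ := Filter.eventually_prod_iff.1 h1
  obtain ⟨r, hr, hr'⟩ := Metric.eventually_nhds_iff.1 hp
  exact ⟨r, hr, {v | q v}, hq, fun τ hτ v hv => hpq (hr' (by simpa using hτ)) hv⟩

variable (hi : (i₁ : ℕ) = i₀ + 1)
include hi

theorem pencil_left (τ : ℂ) (v : W) : pencil w i₀ i₁ τ v i₀ = w i₀ + τ • v := by
  have : i₀ ≠ i₁ := fun h => by rw [h] at hi; omega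
  simp [pencil, this]

theorem flat_pencil {τ : ℂ} {v : W} {z : Z} :
    z ∈ D.flat (pencil w i₀ i₁ τ v) i₀ ↔ z ∈ D.flat w i₀ := by
  refine forall_congr' fun l => forall_congr' fun hl => ?_
  have h1 : l ≠ i₀ := fun h => by simp [h] at hl
  have h2 : l ≠ i₁ := fun h => by rw [h] at hl; omega
  simp [pencil, h1, h2]

theorem flat_pencil_succ {τ : ℂ} {v : W} {z : Z} :
    z ∈ D.flat (pencil w i₀ i₁ τ v) (i₀ + 1) ↔ z ∈ D.flat w i₀ ∧ D.B z (w i₀ + τ • v) = 0 := by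
  rw [mem_flat_succ, D.flat_pencil hi, pencil_left hi]

/-- The axis: because the next entry is `v` itself, the two equations together no longer depend on
`τ`. -/
theorem flat_pencil_succ_succ {τ : ℂ} {v : W} {z : Z} :
    z ∈ D.flat (pencil w i₀ i₁ τ v) (i₀ + 1 + 1) ↔
      z ∈ D.flat w i₀ ∧ D.B z (w i₀) = 0 ∧ D.B z v = 0 := by
  rw [← hi, mem_flat_succ, hi, D.flat_pencil_succ hi, pencil_right]
  simp only [map_add, map_smul, smul_eq_mul]
  constructor
  · rintro ⟨⟨h1, h2⟩, h3⟩
    exact ⟨h1, by simpa [h3] using h2, h3⟩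
  · rintro ⟨h1, h2, h3⟩
    exact ⟨⟨h1, by simp [h2, h3]⟩, h3⟩

variable [FiniteDimensional ℂ E]

/-- Two functionals vanishing on the axis of a pencil of hyperplane sections are proportional on
each section. -/
theorem Generic.proportional {α : ℕ → ℕ} {τ : ℂ} {v : W}
    (hw : D.Generic α (pencil w i₀ i₁ τ v)) (hα : α (i₀ + 1) ≤ α (i₀ + 1 + 1) + 1)
    (a b : E →ₗ[ℂ] ℂ)
    (ha : ∀ z ∈ D.X, z ∈ D.flat w i₀ → D.B z (w i₀) = 0 → D.B z v = 0 → a (D.F z) = 0)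
    (hb : ∀ z ∈ D.X, z ∈ D.flat w i₀ → D.B z (w i₀) = 0 → D.B z v = 0 → b (D.F z) = 0) :
    ∃ c d : ℂ, (c ≠ 0 ∨ d ≠ 0) ∧ ∀ z ∈ D.X, z ∈ D.flat w i₀ → D.B z (w i₀ + τ • v) = 0 →
      c * a (D.F z) + d * b (D.F z) = 0 := by
  have h := hw.self_of_nhds.2
  have hk := i₁.2
  obtain ⟨c, d, hcd, hs⟩ := exists_combination_eq_zero_on
    (D.sp_anti (pencil w i₀ i₁ τ v) (Nat.le_succ (i₀ + 1)))
    (by rw [h _ (by omega), h _ (by omega)]; exact hα) a b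
    (fun x => D.eq_zero_on_sp a fun z hz hz' => by
      obtain ⟨h1, h2, h3⟩ := (D.flat_pencil_succ_succ hi).1 hz'
      exact ha z hz h1 h2 h3)
    (fun x => D.eq_zero_on_sp b fun z hz hz' => by
      obtain ⟨h1, h2, h3⟩ := (D.flat_pencil_succ_succ hi).1 hz'
      exact hb z hz h1 h2 h3)
  exact ⟨c, d, hcd, fun z hz h1 h2 => hs _ (D.F_mem_sp hz ((D.flat_pencil_succ hi).2 ⟨h1, h2⟩))⟩

variable [FiniteDimensional ℂ Z]

/-- If the dimension drops by at most one at some generic section, so it does at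
the preceding one. -/
theorem Generic.drop_le_one {α : ℕ → ℕ} (hw : D.Generic α w)
    (hker : Module.finrank ℂ (LinearMap.ker (D.B : Z →ₗ[ℂ] W →L[ℂ] ℂ)) + (k + 1) ≤
      Module.finrank ℂ Z) (hα : α (i₀ + 1) ≤ α (i₀ + 1 + 1) + 1) : α i₀ ≤ α (i₀ + 1) + 1 := by
  by_contra! hlt
  have hk := i₁.2
  have hdim := hw.self_of_nhds.2
  obtain ⟨a, b, ha, hb, ⟨s, hs, hbs⟩, hab⟩ := exists_functionals_independent_on
    (S := D.sp w i₀) (T := D.sp w (i₀ + 1))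
    (by rw [hdim _ (by omega), hdim _ (by omega)]; omega)
  have hda : DifferentiableOn ℂ (fun z => a (D.F z)) D.X :=
    (LinearMap.toContinuousLinearMap a).differentiable.comp_differentiableOn D.diff_F
  have hdb : DifferentiableOn ℂ (fun z => b (D.F z)) D.X :=
    (LinearMap.toContinuousLinearMap b).differentiable.comp_differentiableOn D.diff_F
  obtain ⟨r, hr, V, hV, hgen⟩ := hw.exists_pencil D i₀ i₁
  obtain ⟨τ, hτ, hτ0⟩ : ∃ τ : ℂ, ‖τ‖ < r ∧ τ ≠ 0 :=
    ⟨(r / 2 : ℝ), by rw [Complex.norm_real, Real.norm_of_nonneg (by linarith)]; linarith,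
      by exact_mod_cast (by linarith : r / 2 ≠ 0)⟩
  have hle : ∀ v, D.flat (pencil w i₀ i₁ τ v) (i₀ + 1) ≤ D.flat w i₀ :=
    fun v z hz => ((D.flat_pencil_succ hi).1 hz).1
  have hmem : ∀ z ∈ D.X, z ∈ D.flat w i₀ → D.B z (w i₀) = 0 → D.F z ∈ D.sp w (i₀ + 1) :=
    fun z hz h1 h2 => D.F_mem_sp hz ((D.mem_flat_succ i₀).2 ⟨h1, h2⟩)
  -- Both functionals vanish over `flat w (i₀ + 1)`, which contains the axes of all these pencils.
  have hprop : ∀ v ∈ V, ∃ c d : ℂ, (c ≠ 0 ∨ d ≠ 0) ∧ ∀ z ∈ D.X, z ∈ D.flat w i₀ →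
      D.B z (w i₀ + τ • v) = 0 → c * a (D.F z) + d * b (D.F z) = 0 := fun v hv =>
    (hgen τ hτ v hv).proportional D hi hα a b
      (fun z hz h1 h2 _ => ha _ (hmem z hz h1 h2)) (fun z hz h1 h2 _ => hb _ (hmem z hz h1 h2))
  -- If no such point existed, `b ∘ F` would vanish on an open family of members, hence by sweeping
  -- on the whole section, against `b s ≠ 0`.
  obtain ⟨x₀, hx₀, hx₀f, v₀, hv₀, hx₀v, hbx₀⟩ : ∃ x₀ ∈ D.X, x₀ ∈ D.flat w i₀ ∧
      ∃ v₀ ∈ interior V, D.B x₀ (w i₀ + τ • v₀) = 0 ∧ b (D.F x₀) ≠ 0 := by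
    by_contra! hcon
    refine hbs (D.eq_zero_on_sp b (fun z hz hz' => ?_) hs)
    have hvV : interior V ∈ 𝓝 (w i₁) := interior_mem_nhds.2 hV
    obtain ⟨x, hxX, hx⟩ := (hgen τ hτ _ (mem_of_mem_nhds hV)).self_of_nhds.1.2.2
    have hx' := D.flat_anti _ (show (i₀ : ℕ) + 1 ≤ k by omega) hx
    refine D.eq_zero_of_sweep (hle (w i₁)) hτ0 hvV
      (fun z hz => ((D.flat_pencil_succ hi).1 hz).2) hxX hx'
      ((D.flat_pencil_succ hi).1 hx').2 (D.exists_transverse hker _ (by omega) x) hdb ?_ hz hz'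
    intro z hz hzf v hv _ hzv
    exact hcon z hz hzf v hv hzv
  -- Every member through `x₀` has this same ratio of `a ∘ F` to `b ∘ F`, so `a - c • b` vanishes on
  -- all of them and the sweep applies.
  set c := a (D.F x₀) / b (D.F x₀) with hc
  obtain ⟨x, hx, hxc⟩ := hab c
  refine hxc ?_
  have hvV : V ∈ 𝓝 v₀ := mem_interior_iff_mem_nhds.1 hv₀
  refine D.eq_zero_on_sp (a - c • b) (fun z hz hz' => ?_) hx
  refine D.eq_zero_of_sweep (f := fun z => (a - c • b) (D.F z)) (hle v₀) hτ0 hvV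
    (fun z hz => ((D.flat_pencil_succ hi).1 hz).2) hx₀
    ((D.flat_pencil_succ hi).2 ⟨hx₀f, hx₀v⟩) hx₀v
    (D.exists_transverse hker _ (by omega) x₀) (hda.sub (hdb.const_mul c)) ?_ hz hz'
  intro z hz hzf v hv hx₀v' hzv
  obtain ⟨p, q, hpq, h⟩ := hprop v hv
  have h1 := h x₀ hx₀ hx₀f hx₀v'
  have h2 := h z hz hzf hzv
  have ha0 : a (D.F x₀) = c * b (D.F x₀) := by rw [hc]; field_simp
  have h3 : p * c + q = 0 := by
    have : (p * c + q) * b (D.F x₀) = 0 := by rw [ha0] at h1; linear_combination h1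
    exact (mul_eq_zero.1 this).resolve_right hbx₀
  have hp : p ≠ 0 := by
    rintro rfl
    simp at h3
    simp [h3] at hpq
  have : p * (a (D.F z) - c * b (D.F z)) = 0 := by linear_combination h2 - b (D.F z) * h3
  simpa using (mul_eq_zero.1 this).resolve_left hp

end Pencil

end LocalPair
-- Dimension count and derivatives of the orthogonality relation
namespace LocalPair

variable {Z W E : Type*} [NormedAddCommGroup Z] [NormedSpace ℂ Z]
    [NormedAddCommGroup W] [NormedSpace ℂ W] [NormedAddCommGroup E] [NormedSpace ℂ E]
    (D : LocalPair Z W E) {k : ℕ}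

theorem mem_flat_zero (w : Fin k → W) (z : Z) : z ∈ D.flat w 0 := fun _ h => absurd h (by omega)

theorem Generic.mem_Y {D : LocalPair Z W E} {α : ℕ → ℕ} {w : Fin k → W} (h : D.Generic α w)
    (i : Fin k) : w i ∈ D.Y :=
  h.self_of_nhds.1.1 i

theorem Generic.exists_update {D : LocalPair Z W E} {α : ℕ → ℕ} {w : Fin k → W}
    (h : D.Generic α w) (i : Fin k) :
    ∃ V : Set W, IsOpen V ∧ w i ∈ V ∧ ∀ v ∈ V, D.Generic α (Function.update w i v) := by
  have hc : Continuous fun v => Function.update w i v := by fun_prop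
  have h1 : ∀ᶠ v in 𝓝 (w i), D.Generic α (Function.update w i v) := by
    refine hc.continuousAt.eventually ?_
    simpa using h.eventually
  obtain ⟨V, hV, hVo, hw⟩ := eventually_nhds_iff.1 h1
  exact ⟨V, hVo, hw, hV⟩

theorem Generic.exists_B_eq_single {D : LocalPair Z W E} {α : ℕ → ℕ} {w : Fin k → W}
    (h : D.Generic α w) (i : Fin k) : ∃ u, D.B u (w i) = 1 ∧ ∀ l ≠ i, D.B u (w l) = 0 := by
  obtain ⟨u, hu⟩ := D.surjective_of_linearIndependent h.self_of_nhds.1.2.1 (Pi.single i 1)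
  refine ⟨u, by simpa using congrFun hu i, fun l hl => ?_⟩
  simpa [hl] using congrFun hu l

theorem differentiableOn_apply (l : E →L[ℂ] ℂ) : DifferentiableOn ℂ (fun z => l (D.F z)) D.X :=
  l.differentiable.comp_differentiableOn D.diff_F

/-- Some generic tuple near a given one has `G (w i)` not identically zero on `F`. -/
theorem Generic.exists_nonnull {D : LocalPair Z W E} {α : ℕ → ℕ} {w : Fin k → W}
    (h : D.Generic α w) (i : Fin k) :
    ∃ v, D.Generic α (Function.update w i v) ∧ ∃ z ∈ D.X, D.G v (D.F z) ≠ 0 := by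
  obtain ⟨V, hVo, hwV, hV⟩ := h.exists_update i
  obtain ⟨x, hx, -⟩ := h.self_of_nhds.1.2.2
  obtain ⟨z, hz, v, hv, hne⟩ := D.nonnull D.X subset_rfl D.isOpen_X ⟨x, hx⟩ (V ∩ D.Y)
    Set.inter_subset_right (hVo.inter D.isOpen_Y) ⟨w i, hwV, h.mem_Y i⟩
  exact ⟨v, hV v hv.1, z, hz, hne⟩

section Dimension

variable [FiniteDimensional ℂ E]

theorem Generic.one_le {D : LocalPair Z W E} {α : ℕ → ℕ} {w : Fin k → W} (h : D.Generic α w) :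
    1 ≤ α k := by
  obtain ⟨x, hx, hxf⟩ := h.self_of_nhds.1.2.2
  rw [← h.self_of_nhds.2 k le_rfl, Nat.one_le_iff_ne_zero, ← Nat.pos_iff_ne_zero,
    Module.finrank_pos_iff]
  exact ⟨⟨⟨D.F x, D.F_mem_sp hx hxf⟩, 0, fun h => D.F_ne x hx (congrArg Subtype.val h)⟩⟩

/-- `G` at the first entry kills the span over the first section by orthogonality, but, after a
small change of that entry, not the span of all values, by non-nullity. -/
theorem Generic.lt_zero {D : LocalPair Z W E} {α : ℕ → ℕ} {w : Fin k → W} (h : D.Generic α w)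
    (hk : 0 < k) : α 1 < α 0 := by
  obtain ⟨v, hg, z, hz, hne⟩ := h.exists_nonnull ⟨0, hk⟩
  have hd := hg.self_of_nhds.2
  rw [← hd 1 hk, ← hd 0 hk.le]
  refine Submodule.finrank_lt_finrank_of_lt (lt_of_le_of_ne (D.sp_anti _ zero_le_one) fun heq => ?_)
  have hv : Function.update w ⟨0, hk⟩ v ⟨0, hk⟩ = v := by simp
  refine hne (D.eq_zero_on_sp (D.G v : E →ₗ[ℂ] ℂ) (w := Function.update w ⟨0, hk⟩ v) (j := 1)
    (fun y hy hyf => ?_) ?_)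
  · refine D.orth y hy v ?_ ?_
    · have := hg.mem_Y ⟨0, hk⟩
      rwa [hv] at this
    · have := hyf ⟨0, hk⟩ zero_lt_one
      rwa [hv] at this
  · rw [heq]
    exact D.F_mem_sp hz (D.mem_flat_zero _ z)

variable [FiniteDimensional ℂ Z]

/-- If all drops from `α 1` to `α k` were at least two, then `α k ≥ 1` and `α 0 > α 1` would give `α
0 ≥ 2 * k`, more than the dimension of `E`. A drop of at most one therefore occurs, and it
propagates down to the first step. -/
theorem Generic.drops {D : LocalPair Z W E} {α : ℕ → ℕ} {w : Fin k → W} (h : D.Generic α w)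
    (hker : Module.finrank ℂ (LinearMap.ker (D.B : Z →ₗ[ℂ] W →L[ℂ] ℂ)) + (k + 1) ≤
      Module.finrank ℂ Z) (hE : Module.finrank ℂ E + 1 ≤ 2 * k) :
    2 ≤ k ∧ α 0 ≤ α 1 + 1 ∧ α 1 ≤ α 2 + 1 := by
  have hk : 0 < k := by omega
  have h1 := h.lt_zero hk
  have h0 : α 0 ≤ Module.finrank ℂ E := by
    rw [← h.self_of_nhds.2 0 (Nat.zero_le _)]
    exact Submodule.finrank_le _
  have hlast := h.one_le
  have hprop : ∀ j, j + 2 ≤ k → α (j + 1) ≤ α (j + 1 + 1) + 1 → α j ≤ α (j + 1) + 1 :=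
    fun j hj hα => h.drop_le_one D (i₀ := ⟨j, by omega⟩) (i₁ := ⟨j + 1, by omega⟩) rfl hker hα
  obtain ⟨j, hj, hjα⟩ : ∃ j, j + 2 ≤ k ∧ α (j + 1) ≤ α (j + 1 + 1) + 1 := by
    by_contra! hcon
    have : ∀ j, j + 1 ≤ k → α (j + 1) + 2 * j ≤ α 1 := by
      intro j
      induction j with
      | zero => intro _; simp
      | succ j ih =>
        intro hj
        have := hcon j (by omega)
        have := ih (by omega)
        omega
    have := this (k - 1) (by omega)
    rw [Nat.sub_add_cancel hk] at this
    omega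
  have hdown : ∀ j, j + 2 ≤ k → α (j + 1) ≤ α (j + 1 + 1) + 1 → α 1 ≤ α 2 + 1 := by
    intro j
    induction j with
    | zero => intro _ h; simpa using h
    | succ j ih => exact fun hj h => ih (by omega) (hprop (j + 1) hj h)
  have h12 := hdown j hj hjα
  exact ⟨by omega, hprop 0 (by omega) h12, h12⟩

end Dimension

/-- `DG(w) δ` is proportional to `G w` on the image of `F` for every direction `δ`. -/
def Stationary (w : W) : Prop :=
  ∀ δ, ∃ m : ℂ, ∀ z ∈ D.X, fderiv ℂ D.G w δ (D.F z) = m * D.G w (D.F z)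

/-- Differentiate the orthogonality relation along `w + s • δ` and `x - c s • u`, with `c` chosen to
keep `B` equal to zero. The term from `F` is a multiple of `G w (dF u)`, so only the derivative of
`G` survives. -/
theorem fderiv_apply_eq_zero {w : W} (hw : w ∈ D.Y) {u : Z} (hu : D.B u w ≠ 0) {x : Z}
    (hx : x ∈ D.X) (hxw : D.B x w = 0) (hd : D.G w (fderiv ℂ D.F x u) = 0) (δ : W) :
    fderiv ℂ D.G w δ (D.F x) = 0 := by
  let c : ℂ → ℂ := fun s => s * D.B x δ / (D.B u w + s * D.B u δ)
  have hc0 : c 0 = 0 := by simp [c]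
  obtain ⟨c', hc⟩ : ∃ c', HasDerivAt c c' 0 := by
    have : DifferentiableAt ℂ c 0 := by
      refine DifferentiableAt.div (by fun_prop) (by fun_prop) ?_
      simpa using hu
    exact ⟨_, this.hasDerivAt⟩
  have hz : HasDerivAt (fun s => x - c s • u) (-(c' • u)) 0 := by
    simpa using (hc.smul_const u).const_sub x
  have hw' : HasDerivAt (fun s : ℂ => w + s • δ) δ 0 := by
    simpa using ((hasDerivAt_id (0 : ℂ)).smul_const δ).const_add w
  have hG : HasDerivAt (fun s : ℂ => D.G (w + s • δ)) (fderiv ℂ D.G w δ) 0 := by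
    refine HasFDerivAt.comp_hasDerivAt (0 : ℂ) (l := D.G) ?_ hw'
    simpa using (D.diff_G.differentiableAt (D.isOpen_Y.mem_nhds hw)).hasFDerivAt
  have hF : HasDerivAt (fun s : ℂ => D.F (x - c s • u)) (fderiv ℂ D.F x (-(c' • u))) 0 := by
    refine HasFDerivAt.comp_hasDerivAt (0 : ℂ) (l := D.F) ?_ hz
    simpa [hc0] using (D.diff_F.differentiableAt (D.isOpen_X.mem_nhds hx)).hasFDerivAt
  have hprod := hG.clm_apply hF
  have hev : (fun s : ℂ => D.G (w + s • δ) (D.F (x - c s • u))) =ᶠ[𝓝 0] fun _ => 0 := by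
    have h1 : ∀ᶠ s : ℂ in 𝓝 0, w + s • δ ∈ D.Y :=
      hw'.continuousAt.eventually (D.isOpen_Y.mem_nhds (by simpa using hw))
    have h2 : ∀ᶠ s : ℂ in 𝓝 0, x - c s • u ∈ D.X :=
      hz.continuousAt.eventually (D.isOpen_X.mem_nhds (by simpa [hc0] using hx))
    have h3 : ∀ᶠ s : ℂ in 𝓝 0, D.B u w + s * D.B u δ ≠ 0 := by
      have : Continuous fun s : ℂ => D.B u w + s * D.B u δ := by fun_prop
      exact this.continuousAt.eventually_ne (by simpa using hu)
    filter_upwards [h1, h2, h3] with s a b e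
    refine D.orth _ b _ a ?_
    simp only [c, map_sub, map_add, map_smul, smul_eq_mul, sub_apply, smul_apply, hxw]
    field_simp
    ring
  have h0 := hprod.unique ((hasDerivAt_const (0 : ℂ) (0 : ℂ)).congr_of_eventuallyEq hev)
  simpa [hc0, hd] using h0

/-- `G w ∘ F` vanishes near `x` on the hyperplane `B · w = 0`, so its differential at `x` vanishes
on the kernel of `B · w`. -/
theorem exists_fderiv_eq_mul {w : W} (hw : w ∈ D.Y) {x : Z} (hx : x ∈ D.X) (hxw : D.B x w = 0) :
    ∃ m : ℂ, ∀ u, D.G w (fderiv ℂ D.F x u) = m * D.B u w := by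
  refine exists_eq_mul_of_ker_le ((D.B.flip w : Z →L[ℂ] ℂ) : Z →ₗ[ℂ] ℂ)
    ((D.G w ∘L fderiv ℂ D.F x : Z →L[ℂ] ℂ) : Z →ₗ[ℂ] ℂ) fun u hu => ?_
  have hz : HasDerivAt (fun s : ℂ => x + s • u) u 0 := by
    simpa using ((hasDerivAt_id (0 : ℂ)).smul_const u).const_add x
  have hF : HasDerivAt (fun s : ℂ => D.F (x + s • u)) (fderiv ℂ D.F x u) 0 := by
    refine HasFDerivAt.comp_hasDerivAt (0 : ℂ) (l := D.F) ?_ hz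
    simpa using (D.diff_F.differentiableAt (D.isOpen_X.mem_nhds hx)).hasFDerivAt
  have hGF := (D.G w).hasFDerivAt.comp_hasDerivAt (0 : ℂ) hF
  have hev : ((D.G w) ∘ fun s : ℂ => D.F (x + s • u)) =ᶠ[𝓝 0] fun _ => 0 := by
    have h2 : ∀ᶠ s : ℂ in 𝓝 0, x + s • u ∈ D.X :=
      hz.continuousAt.eventually (D.isOpen_X.mem_nhds (by simpa using hx))
    filter_upwards [h2] with s b
    refine D.orth _ b _ hw ?_
    have : D.B u w = 0 := hu
    simp [hxw, this]
  exact hGF.unique ((hasDerivAt_const (0 : ℂ) (0 : ℂ)).congr_of_eventuallyEq hev)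

end LocalPair
-- Stationary points and the local factorization
namespace LocalPair

variable {Z W E : Type*} [NormedAddCommGroup Z] [NormedSpace ℂ Z]
    [NormedAddCommGroup W] [NormedSpace ℂ W] [NormedAddCommGroup E] [NormedSpace ℂ E]
    {D : LocalPair Z W E} {k : ℕ}

/-- Over a ball of stationary points, the functions `w ↦ G w (F z)` are proportional. -/
theorem mul_eq_mul_of_stationary {w₀ : W} {ρ : ℝ} (hρ : Metric.ball w₀ ρ ⊆ D.Y)
    (hs : ∀ w ∈ Metric.ball w₀ ρ, D.Stationary w) {z z₁ : Z} (hz : z ∈ D.X) (hz₁ : z₁ ∈ D.X)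
    (hne : ∀ w ∈ Metric.ball w₀ ρ, D.G w (D.F z₁) ≠ 0) {w : W} (hw : w ∈ Metric.ball w₀ ρ) :
    D.G w (D.F z) * D.G w₀ (D.F z₁) = D.G w₀ (D.F z) * D.G w (D.F z₁) := by
  have hG : ∀ w ∈ Metric.ball w₀ ρ, DifferentiableAt ℂ D.G w := fun w hw =>
    D.diff_G.differentiableAt (D.isOpen_Y.mem_nhds (hρ hw))
  have hd : ∀ w ∈ Metric.ball w₀ ρ,
      DifferentiableAt ℂ (fun w => D.G w (D.F z) / D.G w (D.F z₁)) w := fun w hw => by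
    have hx : ∀ x, DifferentiableAt ℂ (fun w => D.G w x) w := fun x =>
      (hG w hw).clm_apply (differentiableAt_const x)
    simp only [div_eq_mul_inv]
    exact (hx _).mul ((hx _).inv (hne w hw))
  -- Stationarity multiplies numerator and denominator by the same factor `m`, so the quotient has
  -- zero derivative.
  have h0 : (Metric.ball w₀ ρ).EqOn
      (fderiv ℂ (fun w => D.G w (D.F z) / D.G w (D.F z₁))) 0 := by
    intro w hw
    ext δ
    have hl : HasDerivAt (fun s : ℂ => w + s • δ) δ 0 := by
      simpa using ((hasDerivAt_id (0 : ℂ)).smul_const δ).const_add w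
    have hGl : HasDerivAt (fun s : ℂ => D.G (w + s • δ)) (fderiv ℂ D.G w δ) 0 := by
      refine HasFDerivAt.comp_hasDerivAt (0 : ℂ) (l := D.G) ?_ hl
      simpa using (hG w hw).hasFDerivAt
    have hev : ∀ x, HasDerivAt (fun s : ℂ => D.G (w + s • δ) x) (fderiv ℂ D.G w δ x) 0 := fun x => by
      simpa using hGl.clm_apply (hasDerivAt_const (0 : ℂ) x)
    have h1 := (hev (D.F z)).div (hev (D.F z₁)) (by simpa using hne w hw)
    have h2 : HasDerivAt (fun s : ℂ => D.G (w + s • δ) (D.F z) / D.G (w + s • δ) (D.F z₁))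
        (fderiv ℂ (fun w => D.G w (D.F z) / D.G w (D.F z₁)) w δ) 0 := by
      refine HasFDerivAt.comp_hasDerivAt (0 : ℂ)
        (l := fun w => D.G w (D.F z) / D.G w (D.F z₁)) ?_ hl
      simpa using (hd w hw).hasFDerivAt
    rw [h2.unique h1]
    obtain ⟨m, hm⟩ := hs w hw δ
    simp only [zero_smul, add_zero, hm z hz, hm z₁ hz₁, Pi.zero_apply, zero_apply]
    ring
  have hw₀ : w₀ ∈ Metric.ball w₀ ρ := by
    have := (dist_nonneg (x := w) (y := w₀)).trans_lt (Metric.mem_ball.1 hw)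
    simpa using this
  have h := Metric.isOpen_ball.is_const_of_fderiv_eq_zero
    (Metric.isConnected_ball (dist_nonneg.trans_lt (Metric.mem_ball.1 hw))).isPreconnected
    (fun w hw => (hd w hw).differentiableWithinAt) h0 hw hw₀
  exact (div_eq_div_iff (hne w hw) (hne w₀ hw₀)).1 h

/-- Along a pencil through a point where `G ∘ F` vanishes to first order only, `G w ∘ F` and
`B · w` change by proportional factors. -/
theorem exists_pencil_ratio [FiniteDimensional ℂ E] {α : ℕ → ℕ} {w : Fin k → W} {i₀ i₁ : Fin k} (hi₀ : (i₀ : ℕ) = 0)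
    (hi₁ : (i₁ : ℕ) = 1) {r : ℝ} {v : W}
    (hgen : ∀ τ : ℂ, ‖τ‖ < r → D.Generic α (pencil w i₀ i₁ τ v)) (hα : α 1 ≤ α 2 + 1)
    {x₀ : Z} (hx₀ : x₀ ∈ D.X) (hx₀w : D.B x₀ (w i₀) = 0) (hx₀v : D.B x₀ v = 0)
    (hd : ∃ u, D.G (w i₀) (fderiv ℂ D.F x₀ u) ≠ 0) {ε : ℂ} (hε : ε ≠ 0) (hεr : ‖ε‖ < r) :
    ∃ κ : ℂ, ∀ z ∈ D.X, D.G (w i₀ + ε • v) (D.F z) * D.B z (w i₀) =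
      κ * (D.G (w i₀) (D.F z) * D.B z (w i₀ + ε • v)) := by
  have hi : (i₁ : ℕ) = i₀ + 1 := by omega
  have hY : ∀ τ : ℂ, ‖τ‖ < r → w i₀ + τ • v ∈ D.Y := fun τ hτ => by
    have := (hgen τ hτ).mem_Y i₀
    rwa [pencil_left hi] at this
  have hr : 0 < r := (norm_nonneg ε).trans_lt hεr
  have hY0 : w i₀ ∈ D.Y := by simpa using hY 0 (by simpa using hr)
  set w₃ := w i₀ + ε • v with hw₃
  have hY3 : w₃ ∈ D.Y := hY ε hεr
  -- Both hyperplanes contain the axis point `x₀`; the sought constant `κ` is the ratio `m₃ / m₁` of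
  -- the two differentials there.
  obtain ⟨m₁, hm₁⟩ := D.exists_fderiv_eq_mul hY0 hx₀ hx₀w
  obtain ⟨m₃, hm₃⟩ := D.exists_fderiv_eq_mul hY3 hx₀ (by simp [hw₃, hx₀w, hx₀v])
  have hm₁0 : m₁ ≠ 0 := by
    rintro rfl
    obtain ⟨u, hu⟩ := hd
    exact hu (by simp [hm₁])
  have hB3 : ∀ {z : Z} {τ : ℂ}, D.B z (w i₀ + τ • v) = 0 → D.B z (w i₀) = -τ * D.B z v ∧
      D.B z w₃ = (ε - τ) * D.B z v := fun {z τ} h => by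
    simp only [map_add, map_smul, smul_eq_mul] at h
    constructor
    · linear_combination h
    · simp only [hw₃, map_add, map_smul, smul_eq_mul]
      linear_combination h
  have key : ∀ τ : ℂ, ‖τ‖ < r → τ ≠ 0 → τ ≠ ε → ∀ z ∈ D.X, D.B z (w i₀ + τ • v) = 0 →
      D.G w₃ (D.F z) * D.B z (w i₀) - m₃ / m₁ * (D.G (w i₀) (D.F z) * D.B z w₃) = 0 := by
    intro τ hτ hτ0 hτε z hz hzτ
    obtain ⟨c, d, hcd, hs⟩ := (hgen τ hτ).proportional D hi (by simpa [hi₀] using hα)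
      (D.G (w i₀) : E →ₗ[ℂ] ℂ) (D.G w₃ : E →ₗ[ℂ] ℂ)
      (fun z hz _ h1 _ => D.orth z hz _ hY0 h1)
      (fun z hz _ h1 h2 => D.orth z hz _ hY3 (by simp [hw₃, h1, h2]))
    have hs' : ∀ z ∈ D.X, D.B z (w i₀ + τ • v) = 0 →
        c * D.G (w i₀) (D.F z) + d * D.G w₃ (D.F z) = 0 := fun z hz h =>
      hs z hz (by rw [hi₀]; exact D.mem_flat_zero w z) h
    -- A direction inside the member `τ` but transverse to the axis. Differentiating the
    -- proportionality at `x₀` along it gives `c * τ * m₁ = d * (ε - τ) * m₃`, which fixes the ratio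
    -- on that member.
    obtain ⟨y, hy1, hy2⟩ := (hgen τ hτ).exists_B_eq_single i₁
    rw [pencil_right] at hy1
    have hy2 := hy2 i₀ (fun h => by rw [h] at hi; omega)
    rw [pencil_left hi] at hy2
    have hline : HasDerivAt (fun s : ℂ => x₀ + s • y) y 0 := by
      simpa using ((hasDerivAt_id (0 : ℂ)).smul_const y).const_add x₀
    have hF : HasDerivAt (fun s : ℂ => D.F (x₀ + s • y)) (fderiv ℂ D.F x₀ y) 0 := by
      refine HasFDerivAt.comp_hasDerivAt (0 : ℂ) (l := D.F) ?_ hline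
      simpa using (D.diff_F.differentiableAt (D.isOpen_X.mem_nhds hx₀)).hasFDerivAt
    have h1 := (((D.G (w i₀)).hasFDerivAt.comp_hasDerivAt (0 : ℂ) hF).const_mul c).add
      (((D.G w₃).hasFDerivAt.comp_hasDerivAt (0 : ℂ) hF).const_mul d)
    have h2 := h1.unique ((hasDerivAt_const (0 : ℂ) (0 : ℂ)).congr_of_eventuallyEq (by
      have hX : ∀ᶠ s : ℂ in 𝓝 0, x₀ + s • y ∈ D.X :=
        hline.continuousAt.eventually (D.isOpen_X.mem_nhds (by simpa using hx₀))
      filter_upwards [hX] with s hs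
      refine hs' _ hs ?_
      have : D.B x₀ (w i₀ + τ • v) = 0 := by simp [hx₀w, hx₀v]
      rw [map_add D.B, map_smul D.B, add_apply, smul_apply, this, hy2]
      simp))
    rw [hm₁, hm₃, (hB3 hy2).1, (hB3 hy2).2, hy1] at h2
    have hd0 : d ≠ 0 := by
      rintro rfl
      simp [hm₁0, hτ0] at h2
      simp [h2] at hcd
    have h3 := hs' z hz hzτ
    rw [(hB3 hzτ).1, (hB3 hzτ).2]
    have hετ : d * (ε - τ) ≠ 0 := mul_ne_zero hd0 (sub_ne_zero.2 hτε.symm)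
    have hm : m₃ / m₁ = c * τ / (d * (ε - τ)) := by
      rw [div_eq_div_iff hm₁0 hετ]
      linear_combination h2
    have h4 : D.G w₃ (D.F z) = -(c / d) * D.G (w i₀) (D.F z) := by
      field_simp
      linear_combination h3
    have hετ' : ε - τ ≠ 0 := right_ne_zero_of_mul hετ
    rw [hm, h4]
    field_simp
    ring
  refine ⟨m₃ / m₁, fun z hz => sub_eq_zero.1 ?_⟩
  -- The member `ε / 2` avoids the exceptional values `0` and `ε`. Near a point of it off the axis,
  -- each `z` lies on a single admissible member, with parameter `τ z` below.
  have hτr : ‖ε / 2‖ < r := by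
    rw [norm_div, Complex.norm_ofNat]
    linarith [norm_nonneg ε]
  obtain ⟨y, hy1, hy2⟩ := (hgen (ε / 2) hτr).exists_B_eq_single i₁
  rw [pencil_right] at hy1
  have hy2 := hy2 i₀ (fun h => by rw [h] at hi; omega)
  rw [pencil_left hi] at hy2
  obtain ⟨s, hsX, hs0⟩ : ∃ s : ℂ, x₀ + s • y ∈ D.X ∧ s ≠ 0 := by
    have hcont : Continuous fun s : ℂ => x₀ + s • y := by fun_prop
    have h1 : ∀ᶠ s in 𝓝 (0 : ℂ), x₀ + s • y ∈ D.X :=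
      hcont.continuousAt.eventually (D.isOpen_X.mem_nhds (by simpa using hx₀))
    obtain ⟨s, h, h'⟩ := ((h1.filter_mono nhdsWithin_le_nhds).and
      (self_mem_nhdsWithin : ∀ᶠ s in 𝓝[≠] (0 : ℂ), s ∈ ({0}ᶜ : Set ℂ))).exists
    exact ⟨s, h, h'⟩
  set p := x₀ + s • y with hp
  have hpv : D.B p v = s := by simp [hp, hx₀v, hy1]
  have hpw : D.B p (w i₀) = -(ε / 2) * s := by
    rw [(hB3 (z := p) (τ := ε / 2) ?_).1, hpv]
    have : D.B x₀ (w i₀ + (ε / 2) • v) = 0 := by simp [hx₀w, hx₀v]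
    rw [hp, map_add D.B, map_smul D.B, add_apply, smul_apply, this, hy2]
    simp
  have hBc : ∀ x : W, Continuous fun y' => D.B y' x := fun x => (D.B.flip x).continuous
  let τ : Z → ℂ := fun z => -(D.B z (w i₀) / D.B z v)
  have hτp : τ p = ε / 2 := by
    simp only [τ, hpv, hpw]
    field_simp
  have hτc : ContinuousAt τ p :=
    ((hBc _).continuousAt.div (hBc _).continuousAt (by rw [hpv]; exact hs0)).neg
  refine eq_zero_of_eventually_eq_zero_on_subspace D.isOpen_X D.convex_X
    (f := fun z => D.G w₃ (D.F z) * D.B z (w i₀) - m₃ / m₁ * (D.G (w i₀) (D.F z) * D.B z w₃))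
    ?_ ⊤ hsX trivial ?_ hz trivial
  · have hBd : ∀ x : W, DifferentiableOn ℂ (fun y' => D.B y' x) D.X := fun x =>
      (D.B.flip x).differentiable.differentiableOn
    exact ((D.differentiableOn_apply _).mul (hBd _)).sub
      (((D.differentiableOn_apply _).mul (hBd _)).const_mul _)
  · have e1 : ∀ᶠ z in 𝓝 p, ‖τ z‖ < r :=
      hτc.norm.eventually (Iio_mem_nhds (by simpa only [hτp] using hτr))
    have e2 : ∀ᶠ z in 𝓝 p, τ z ≠ 0 := hτc.eventually_ne (by rw [hτp]; simpa using hε)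
    have e3 : ∀ᶠ z in 𝓝 p, τ z ≠ ε := hτc.eventually_ne (by
      rw [hτp]
      intro h
      apply hε
      linear_combination (-2 : ℂ) * h)
    have e4 : ∀ᶠ z in 𝓝 p, D.B z v ≠ 0 :=
      (hBc v).continuousAt.eventually_ne (by rw [hpv]; exact hs0)
    filter_upwards [e1, e2, e3, e4, D.isOpen_X.mem_nhds hsX] with z h1 h2 h3 h4 h5 _
    refine key (τ z) h1 h2 h3 z h5 ?_
    simp only [τ, map_add, map_smul, smul_eq_mul]
    field_simp
    ring

variable [FiniteDimensional ℂ Z]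

/-- There is a generic tuple whose first entry is not stationary. -/
theorem Generic.exists_not_stationary {α : ℕ → ℕ} {w : Fin k → W} (h : D.Generic α w)
    (hker : Module.finrank ℂ (LinearMap.ker (D.B : Z →ₗ[ℂ] W →L[ℂ] ℂ)) + (k + 1) ≤
      Module.finrank ℂ Z) {i₀ : Fin k} (hi₀ : (i₀ : ℕ) = 0) :
    ∃ w' : Fin k → W, D.Generic α w' ∧ ¬ D.Stationary (w' i₀) ∧
      ∃ z ∈ D.X, D.G (w' i₀) (D.F z) ≠ 0 := by
  obtain ⟨v, hv, z₁, hz₁, hne⟩ := h.exists_nonnull i₀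
  generalize hu : Function.update w i₀ v = u at hv
  have hui : u i₀ = v := by simp [← hu]
  rw [← hui] at hne
  obtain ⟨V, hVo, huV, hV⟩ := hv.exists_update i₀
  have hcont : ContinuousAt (fun w => D.G w (D.F z₁)) (u i₀) :=
    ((D.diff_G.differentiableAt (D.isOpen_Y.mem_nhds (hv.mem_Y i₀))).continuousAt).clm_apply
      continuousAt_const
  obtain ⟨ρ, hρ, hball⟩ := Metric.eventually_nhds_iff_ball.1
    ((hcont.eventually_ne hne).and (hVo.mem_nhds huV : ∀ᶠ w in 𝓝 (u i₀), w ∈ V))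
  by_contra! hcon
  have hgen : ∀ v ∈ Metric.ball (u i₀) ρ, D.Generic α (Function.update u i₀ v) :=
    fun v hv => hV v (hball v hv).2
  have hstat : ∀ v ∈ Metric.ball (u i₀) ρ, D.Stationary v := by
    intro v hv
    by_contra hns
    have := hcon _ (hgen v hv) (by simpa using hns) z₁ hz₁
    exact (hball v hv).1 (by simpa using this)
  have hY : Metric.ball (u i₀) ρ ⊆ D.Y := fun v hv => by
    simpa using (hgen v hv).mem_Y i₀
  obtain ⟨x, hx, hxf⟩ := hv.self_of_nhds.1.2.2
  -- If all nearby `v` were stationary, the zeros of `G v ∘ F` on `B · v = 0` would be zeros of `G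
  -- (u i₀) ∘ F`, and these hyperplanes sweep out an open set.
  refine hne (D.eq_zero_of_sweep (Λ := ⊤) (Λ' := D.flat u 1) le_top (c := 0) (v₀ := u i₀)
    one_ne_zero (Metric.ball_mem_nhds _ hρ) (fun z hz => ?_) hx
    (D.flat_anti u (by have := i₀.2; omega : 1 ≤ k) hxf) (x₀ := 0) (by simp) ?_
    (D.differentiableOn_apply (D.G (u i₀))) (fun z hz _ v hv _ hzv => ?_) hz₁ trivial)
  · simpa using hz i₀ (by omega)
  · obtain ⟨p, hp, δ, hδ⟩ := D.exists_B_ne_zero hker u (by have := i₀.2; omega : 1 ≤ k)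
    exact ⟨p, hp, δ, by simp, hδ⟩
  · have h1 := mul_eq_mul_of_stationary hY hstat hz hz₁ (fun w hw => (hball w hw).1) hv
    rw [D.orth z hz v (hY hv) (by simpa using hzv), zero_mul] at h1
    exact (mul_eq_zero.1 h1.symm).resolve_right (hball v hv).1

variable [FiniteDimensional ℂ E]

/-- Where `G ∘ dF` vanishes, differentiated orthogonality makes the derivative of `G` vanish on `F`.
Sweeping extends this to the first section, and a first drop of at most one then makes that
derivative proportional to `G` on all values of `F`. -/
theorem Generic.stationary {α : ℕ → ℕ} {w : Fin k → W} (h : D.Generic α w)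
    (hker : Module.finrank ℂ (LinearMap.ker (D.B : Z →ₗ[ℂ] W →L[ℂ] ℂ)) + (k + 1) ≤
      Module.finrank ℂ Z) {i₀ i₁ : Fin k} (hi₀ : (i₀ : ℕ) = 0) (hi₁ : (i₁ : ℕ) = 1)
    (hα : α 0 ≤ α 1 + 1)
    (hne : ∃ z ∈ D.X, D.G (w i₀) (D.F z) ≠ 0) {V : Set W} (hV : V ∈ 𝓝 (w i₁))
    (hd : ∀ v ∈ V, ∀ x ∈ D.X, D.B x (w i₀) = 0 → D.B x v = 0 → ∀ u,
      D.G (w i₀) (fderiv ℂ D.F x u) = 0) : D.Stationary (w i₀) := by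
  intro δ
  have hk := i₁.2
  have hdim := h.self_of_nhds.2
  obtain ⟨u, hu, -⟩ := h.exists_B_eq_single i₀
  obtain ⟨x, hx, hxf⟩ := h.self_of_nhds.1.2.2
  have hflat : ∀ z, z ∈ D.flat w 1 → D.B z (w i₀) = 0 := fun z hz => hz i₀ (by omega)
  have h1 : ∀ z ∈ D.X, z ∈ D.flat w 1 → fderiv ℂ D.G (w i₀) δ (D.F z) = 0 := by
    intro z hz hzf
    refine D.eq_zero_of_sweep (Λ' := D.flat w 2) (D.flat_anti w one_le_two) (c := 0)
      one_ne_zero hV (fun y hy => ?_) hx (D.flat_anti w (by omega : 2 ≤ k) hxf) (x₀ := 0)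
      (by simp) ?_ (D.differentiableOn_apply (fderiv ℂ D.G (w i₀) δ))
      (fun y hy hyf v hv _ hyv => ?_) hz hzf
    · simpa using hy i₁ (by omega)
    · obtain ⟨p, hp, δ, hδ⟩ := D.exists_B_ne_zero hker w (by omega : 2 ≤ k)
      exact ⟨p, hp, δ, by simp, hδ⟩
    · exact D.fderiv_apply_eq_zero (h.mem_Y i₀) (u := u) (by simp [hu]) hy (hflat y hyf)
        (hd v hv y hy (hflat y hyf) (by simpa using hyv) u) δ
  obtain ⟨c, d, hcd, hs⟩ := exists_combination_eq_zero_on (D.sp_anti w zero_le_one)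
    (by rw [hdim 0 (by omega), hdim 1 (by omega)]; exact hα)
    (fderiv ℂ D.G (w i₀) δ : E →ₗ[ℂ] ℂ) (D.G (w i₀) : E →ₗ[ℂ] ℂ)
    (fun y hy => D.eq_zero_on_sp _ h1 hy)
    (fun y hy => D.eq_zero_on_sp _
      (fun z hz hzf => D.orth z hz _ (h.mem_Y i₀) (hflat z hzf)) hy)
  have hF : ∀ z ∈ D.X, c * fderiv ℂ D.G (w i₀) δ (D.F z) + d * D.G (w i₀) (D.F z) = 0 :=
    fun z hz => hs _ (D.F_mem_sp hz (D.mem_flat_zero w z))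
  obtain ⟨z₁, hz₁, hne⟩ := hne
  have hc : c ≠ 0 := by
    rintro rfl
    have := hF z₁ hz₁
    simp_all
  refine ⟨-d / c, fun z hz => ?_⟩
  have := hF z hz
  field_simp
  linear_combination this

/-- In the given range of dimensions, the pairing of `F` and `G` is locally the form `B` up to a
product of functions of one variable. -/
theorem exists_factorization (D : LocalPair Z W E)
    (hker : Module.finrank ℂ (LinearMap.ker (D.B : Z →ₗ[ℂ] W →L[ℂ] ℂ)) + (k + 1) ≤
      Module.finrank ℂ Z) (hE : Module.finrank ℂ E + 1 ≤ 2 * k) (hdom : (D.dom k).Nonempty) :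
    ∃ X' ⊆ D.X, IsOpen X' ∧ X'.Nonempty ∧ ∃ Y' ⊆ D.Y, IsOpen Y' ∧ Y'.Nonempty ∧
      ∃ (a : Z → ℂ) (b : W → ℂ), ∀ z ∈ X', ∀ w ∈ Y', D.G w (D.F z) = a z * b w * D.B z w := by
  obtain ⟨α, w', hw'⟩ := D.exists_generic hdom
  obtain ⟨hk, hα0, hα1⟩ := hw'.drops hker hE
  let i₀ : Fin k := ⟨0, by omega⟩
  let i₁ : Fin k := ⟨1, by omega⟩
  have hi : (i₁ : ℕ) = i₀ + 1 := rfl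
  obtain ⟨w, hw, hns, z₂, hz₂, hz₂ne⟩ := hw'.exists_not_stationary hker (i₀ := i₀) rfl
  clear hw' w'
  obtain ⟨r, hr, V, hV, hgen⟩ := hw.exists_pencil D i₀ i₁
  have hBc : ∀ x : W, Continuous fun y' => D.B y' x := fun x => (D.B.flip x).continuous
  obtain ⟨u, hu, -⟩ := hw.exists_B_eq_single i₀
  obtain ⟨z₁, hz₁, hz₁G, hz₁B⟩ : ∃ z ∈ D.X, D.G (w i₀) (D.F z) ≠ 0 ∧ D.B z (w i₀) ≠ 0 := by
    by_contra! hcon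
    refine hz₂ne (eq_zero_of_eventually_eq_zero_on_subspace D.isOpen_X D.convex_X
      (D.differentiableOn_apply (D.G (w i₀))) ⊤ hz₂ trivial ?_ hz₂ trivial)
    exfalso
    have hc : ContinuousAt (fun z => D.G (w i₀) (D.F z)) z₂ :=
      ((D.differentiableOn_apply (D.G (w i₀))).differentiableAt
        (D.isOpen_X.mem_nhds hz₂)).continuousAt
    have h0 := fun z hz => eq_zero_of_eventually_eq_zero_on_subspace (z := z) D.isOpen_X D.convex_X
      (D.B.flip (w i₀)).differentiable.differentiableOn ⊤ hz₂ trivial (by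
        filter_upwards [hc.eventually_ne hz₂ne, D.isOpen_X.mem_nhds hz₂] with z h1 h2 _
        exact hcon z h2 h1) hz trivial
    have hl : Continuous fun s : ℂ => z₂ + s • u := by fun_prop
    have h1 : ∀ᶠ s in 𝓝 (0 : ℂ), z₂ + s • u ∈ D.X :=
      hl.continuousAt.eventually (D.isOpen_X.mem_nhds (by simpa using hz₂))
    obtain ⟨s, h, h'⟩ := ((h1.filter_mono nhdsWithin_le_nhds).and
      (self_mem_nhdsWithin : ∀ᶠ s in 𝓝[≠] (0 : ℂ), s ∈ ({0}ᶜ : Set ℂ))).exists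
    have e1 := h0 _ h
    have e2 := h0 _ hz₂
    simp only [ContinuousLinearMap.flip_apply] at e1 e2
    refine h' ?_
    simpa [e2, hu] using e1
  obtain ⟨ε, hεr, hε, hεB⟩ : ∃ ε : ℂ, ‖ε‖ < r ∧ ε ≠ 0 ∧ D.B z₁ (w i₀ + ε • w i₁) ≠ 0 := by
    have h1 : ∀ᶠ s in 𝓝 (0 : ℂ), ‖s‖ < r :=
      continuous_norm.continuousAt.eventually (Iio_mem_nhds (by simpa using hr))
    have h2 : ∀ᶠ s in 𝓝 (0 : ℂ), D.B z₁ (w i₀ + s • w i₁) ≠ 0 := by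
      have hl : Continuous fun s : ℂ => D.B z₁ (w i₀ + s • w i₁) := by fun_prop
      exact hl.continuousAt.eventually_ne (by simpa using hz₁B)
    obtain ⟨s, ⟨h, h'⟩, h''⟩ := (((h1.and h2).filter_mono nhdsWithin_le_nhds).and
      (self_mem_nhdsWithin : ∀ᶠ s in 𝓝[≠] (0 : ℂ), s ∈ ({0}ᶜ : Set ℂ))).exists
    exact ⟨s, h, h'', h'⟩
  have hY : ∀ v ∈ V, w i₀ + ε • v ∈ D.Y := fun v hv => by
    have := (hgen ε hεr v hv).mem_Y i₀
    rwa [pencil_left hi] at this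
  have hcross : ∀ v ∈ interior V, ∀ z ∈ D.X,
      D.G (w i₀ + ε • v) (D.F z) * D.B z (w i₀) *
          (D.G (w i₀) (D.F z₁) * D.B z₁ (w i₀ + ε • v)) =
        D.G (w i₀ + ε • v) (D.F z₁) * D.B z₁ (w i₀) *
          (D.G (w i₀) (D.F z) * D.B z (w i₀ + ε • v)) := by
    intro v hv z hz
    -- Failure is an open condition on `v`. For all those `v`, `exists_pencil_ratio` rules out a
    -- nonzero `G ∘ dF` on the axis, which would make `w i₀` stationary.
    by_contra hne
    have hGc : ∀ x, ContinuousAt (fun v => D.G (w i₀ + ε • v) x) v := fun x => by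
      have h1 : ContinuousAt D.G (w i₀ + ε • v) :=
        (D.diff_G.differentiableAt (D.isOpen_Y.mem_nhds (hY v (interior_subset hv)))).continuousAt
      have h2 : Continuous fun v => w i₀ + ε • v := by fun_prop
      exact (ContinuousAt.comp (g := D.G) (f := fun v => w i₀ + ε • v) h1 h2.continuousAt).clm_apply continuousAt_const
    have hBc' : ∀ x : Z, Continuous fun v => D.B x (w i₀ + ε • v) := fun x => by fun_prop
    have hev := ContinuousAt.eventually_ne
      ((((hGc (D.F z)).mul continuousAt_const).mul
        (continuousAt_const.mul (hBc' z₁).continuousAt)).sub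
      (((hGc (D.F z₁)).mul continuousAt_const).mul
        (continuousAt_const.mul (hBc' z).continuousAt))) (sub_ne_zero.2 hne)
    have hev' := hev.and (isOpen_interior.mem_nhds hv : ∀ᶠ v in 𝓝 v, v ∈ interior V)
    obtain ⟨V', hV', hV'o, hvV'⟩ := eventually_nhds_iff.1 hev'
    have hV'V : V' ⊆ V := fun x hx => interior_subset (hV' x hx).2
    have hpl : pencil w i₀ i₁ 0 v i₀ = w i₀ := by rw [pencil_left hi, zero_smul, add_zero]
    have hpr : pencil w i₀ i₁ 0 v i₁ = v := pencil_right 0 v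
    refine hns ?_
    rw [← hpl]
    refine (hgen 0 (by simpa using hr) v (hV'V hvV')).stationary hker rfl rfl hα0 (V := V')
      (by rw [hpl]; exact ⟨z₂, hz₂, hz₂ne⟩) (by rw [hpr]; exact hV'o.mem_nhds hvV') ?_
    rw [hpl]
    intro v' hv' x hx hxw hxv u
    by_contra hu
    obtain ⟨κ, hκ⟩ := exists_pencil_ratio rfl rfl (fun τ hτ => hgen τ hτ v' (hV'V hv')) hα1 hx hxw
      hxv ⟨u, hu⟩ hε hεr
    refine (hV' v' hv').1 ?_
    simp only [Pi.sub_apply, Pi.mul_apply]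
    linear_combination (D.G (w i₀) (D.F z₁) * D.B z₁ (w i₀ + ε • v')) * hκ z hz -
      (D.G (w i₀) (D.F z) * D.B z (w i₀ + ε • v')) * hκ z₁ hz₁
  -- With `v = ε⁻¹ • (y - w i₀)` the point `w i₀ + ε • v` is an arbitrary `y` in an open set;
  -- dividing the cross relation by the values at `z₁` separates the variables.
  refine ⟨D.X ∩ {z | D.B z (w i₀) ≠ 0}, Set.inter_subset_left,
    D.isOpen_X.inter (isOpen_ne_fun (hBc _) continuous_const), ⟨z₁, hz₁, hz₁B⟩,
    {y | ε⁻¹ • (y - w i₀) ∈ interior V} ∩ {y | D.B z₁ y ≠ 0}, ?_, ?_, ?_,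
    fun z => D.G (w i₀) (D.F z) / D.B z (w i₀),
    fun y => D.G y (D.F z₁) * D.B z₁ (w i₀) / (D.G (w i₀) (D.F z₁) * D.B z₁ y), ?_⟩
  · rintro y ⟨hy, -⟩
    have := hY _ (interior_subset hy)
    rwa [smul_inv_smul₀ hε, add_sub_cancel] at this
  · exact (isOpen_interior.preimage (by fun_prop)).inter
      (isOpen_ne_fun (by fun_prop) continuous_const)
  · refine ⟨w i₀ + ε • w i₁, ?_, hεB⟩
    simpa [inv_smul_smul₀ hε] using mem_interior_iff_mem_nhds.2 hV
  · rintro z ⟨hz, hzB⟩ y ⟨hy, hyB⟩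
    have := hcross _ hy z hz
    rw [smul_inv_smul₀ hε, add_sub_cancel] at this
    have hzB' : D.B z (w i₀) ≠ 0 := hzB
    have hyB' : D.B z₁ y ≠ 0 := hyB
    field_simp
    linear_combination this

end LocalPair
-- The Hermitian form and its kernel
section Form

variable {r s t : ℕ}

/-- The complex bilinear form underlying `herm`. -/
noncomputable def bform (r s t : ℕ) : CSpace r s t →L[ℂ] CSpace r s t →L[ℂ] ℂ :=
  ∑ i, sgn r s t i • (ContinuousLinearMap.proj (R := ℂ) (φ := fun _ => ℂ) i).smulRight
    (ContinuousLinearMap.proj (R := ℂ) (φ := fun _ => ℂ) i)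

theorem bform_apply (z w : CSpace r s t) : bform r s t z w = ∑ i, sgn r s t i * z i * w i := by
  simp [bform, mul_assoc]

theorem herm_eq_bform (z w : CSpace r s t) : herm r s t z w = bform r s t z (star w) := by
  simp [herm, bform_apply]

theorem herm_star (z w : CSpace r s t) : herm r s t z (star w) = bform r s t z w := by
  rw [herm_eq_bform, star_star]

theorem herm_add_left (x y z : CSpace r s t) :
    herm r s t (x + y) z = herm r s t x z + herm r s t y z := by
  simp [herm_eq_bform]

theorem herm_sub_left (x y z : CSpace r s t) :
    herm r s t (x - y) z = herm r s t x z - herm r s t y z := by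
  simp [herm_eq_bform]

theorem herm_smul_left (c : ℂ) (x z : CSpace r s t) :
    herm r s t (c • x) z = c * herm r s t x z := by
  simp [herm_eq_bform]

theorem herm_zero_left (z : CSpace r s t) : herm r s t 0 z = 0 := by
  simp [herm_eq_bform]

theorem herm_add_right (x y z : CSpace r s t) :
    herm r s t x (y + z) = herm r s t x y + herm r s t x z := by
  simp [herm_eq_bform]

theorem herm_smul_right (c : ℂ) (x z : CSpace r s t) :
    herm r s t x (c • z) = conj c * herm r s t x z := by
  simp [herm_eq_bform]

theorem herm_zero_right (x : CSpace r s t) : herm r s t x 0 = 0 := by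
  simp [herm_eq_bform]

theorem conj_herm (z w : CSpace r s t) : conj (herm r s t z w) = herm r s t w z := by
  have : ∀ i, conj (sgn r s t i) = sgn r s t i := fun i => by
    unfold sgn
    split_ifs <;> simp
  simp only [herm, map_sum, map_mul, this, Complex.conj_conj]
  exact Finset.sum_congr rfl fun i _ => by ring

theorem herm_eq_zero_comm {z w : CSpace r s t} : herm r s t z w = 0 ↔ herm r s t w z = 0 := by
  rw [← conj_herm w z, map_eq_zero]

theorem sgn_definite {n : ℕ} (i : Fin (n + 0 + 0)) : sgn n 0 0 i = 1 := by
  simp [sgn]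

theorem herm_definite_eq_inner {n : ℕ} (z w : CSpace n 0 0) :
    herm n 0 0 z w = inner ℂ (WithLp.toLp 2 w) (WithLp.toLp 2 z) := by
  simp [herm, sgn_definite, PiLp.inner_apply]

theorem eq_zero_of_herm_self {n : ℕ} {z : CSpace n 0 0} (h : herm n 0 0 z z = 0) : z = 0 := by
  rw [herm_definite_eq_inner, inner_self_eq_zero] at h
  simpa using h

theorem perp_mk {v w : CSpace r s t} (hv : v ≠ 0) (hw : w ≠ 0) :
    Perp r s t (Projectivization.mk ℂ v hv) (Projectivization.mk ℂ w hw) ↔ herm r s t v w = 0 := by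
  simp only [Perp, PerpSub, Projectivization.submodule_mk]
  refine ⟨fun h => h v (Submodule.mem_span_singleton_self v) w
    (Submodule.mem_span_singleton_self w), fun h x hx y hy => ?_⟩
  obtain ⟨c, rfl⟩ := Submodule.mem_span_singleton.1 hx
  obtain ⟨d, rfl⟩ := Submodule.mem_span_singleton.1 hy
  rw [herm_smul_left, herm_smul_right, h]
  simp

theorem finrank_ker_bform :
    Module.finrank ℂ (LinearMap.ker (bform r s t : CSpace r s t →ₗ[ℂ] CSpace r s t →L[ℂ] ℂ)) +
      (r + s) ≤ Module.finrank ℂ (CSpace r s t) := by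
  let L : CSpace r s t →ₗ[ℂ] (Fin (r + s) → ℂ) := LinearMap.funLeft ℂ ℂ (Fin.castAdd t)
  have hL : LinearMap.range L = ⊤ :=
    LinearMap.range_eq_top.2 (LinearMap.funLeft_surjective_of_injective ℂ ℂ _
      (Fin.castAdd_injective _ _))
  have hle : LinearMap.ker (bform r s t : CSpace r s t →ₗ[ℂ] CSpace r s t →L[ℂ] ℂ) ≤
      LinearMap.ker L := by
    intro z hz
    rw [LinearMap.mem_ker] at hz ⊢
    funext i
    have h1 : bform r s t z (Pi.single (Fin.castAdd t i) 1) = 0 := DFunLike.congr_fun hz _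
    have hs : sgn r s t (Fin.castAdd t i) ≠ 0 := by
      have := i.2
      unfold sgn
      simp only [Fin.val_castAdd]
      split_ifs <;> simp
    rw [bform_apply, Finset.sum_eq_single (Fin.castAdd t i)] at h1
    · simpa [hs, L] using h1
    · intro j _ hj
      simp [hj]
    · simp
  have h1 := Submodule.finrank_mono hle
  have h2 := LinearMap.finrank_range_add_finrank_ker L
  rw [hL, finrank_top, Module.finrank_fin_fun] at h2
  omega

end Form

/-! ### Lifts and the identity theorem on projective space -/

section Identity

variable {m n : ℕ}

/-- The open cone over an open subset of projective space. -/
theorem isOpen_cone {U : Set (ℙ ℂ (Fin m → ℂ))} (hU : IsOpen U) :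
    IsOpen {v : Fin m → ℂ | ∃ hv : v ≠ 0, Projectivization.mk ℂ v hv ∈ U} := by
  have h1 : IsOpen {v : {v : Fin m → ℂ // v ≠ 0} | Projectivization.mk' ℂ v ∈ U} :=
    isOpen_coinduced.1 hU
  convert (isOpen_ne (x := (0 : Fin m → ℂ))).isOpenMap_subtype_val _ h1 using 1
  ext v
  constructor
  · rintro ⟨hv, h⟩
    exact ⟨⟨v, hv⟩, h, rfl⟩
  · rintro ⟨⟨v, hv⟩, h, rfl⟩
    exact ⟨hv, h⟩

/-- The image of an open set in projective space is open. -/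
theorem isOpen_image_mk {N : Set (Fin m → ℂ)} (hN : IsOpen N) :
    IsOpen {p : ℙ ℂ (Fin m → ℂ) | ∃ (v : Fin m → ℂ) (hv : v ≠ 0),
      v ∈ N ∧ Projectivization.mk ℂ v hv = p} := by
  refine isOpen_coinduced.2 ?_
  have : (fun v : {v : Fin m → ℂ // v ≠ 0} => Projectivization.mk' ℂ v) ⁻¹'
      {p : ℙ ℂ (Fin m → ℂ) | ∃ (v : Fin m → ℂ) (hv : v ≠ 0),
        v ∈ N ∧ Projectivization.mk ℂ v hv = p} =
      ⋃ c : ℂˣ, (fun v : {v : Fin m → ℂ // v ≠ 0} => c • (v : Fin m → ℂ)) ⁻¹' N := by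
    ext ⟨v, hv⟩
    simp only [Set.mem_preimage, Set.mem_ofPred_eq, Set.mem_iUnion]
    constructor
    · rintro ⟨v', hv', hN', h⟩
      obtain ⟨c, rfl⟩ := (Projectivization.mk_eq_mk_iff ℂ v' v hv' hv).1 h
      exact ⟨c, hN'⟩
    · rintro ⟨c, hc⟩
      have hcv : c • v ≠ 0 := fun h => hv ((smul_eq_zero_iff_eq c).1 h)
      exact ⟨c • v, hcv, hc, (Projectivization.mk_eq_mk_iff ℂ _ _ hcv hv).2 ⟨c, rfl⟩⟩
  rw [this]
  refine isOpen_iUnion fun c => hN.preimage ?_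
  exact continuous_subtype_val.const_smul c

/-- `f` is a holomorphic lift on the convex open set `X` of the map `φ` on `U`. -/
structure IsLift (U : Set (ℙ ℂ (Fin m → ℂ))) (φ : ℙ ℂ (Fin m → ℂ) → ℙ ℂ (Fin n → ℂ))
    (X : Set (Fin m → ℂ)) (f : (Fin m → ℂ) → (Fin n → ℂ)) : Prop where
  isOpen : IsOpen X
  convex : Convex ℝ X
  diff : DifferentiableOn ℂ f X
  lift : ∀ z ∈ X, ∃ (hz : z ≠ 0) (hf : f z ≠ 0), Projectivization.mk ℂ z hz ∈ U ∧
    φ (Projectivization.mk ℂ z hz) = Projectivization.mk ℂ (f z) hf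

theorem HolomorphicOn.exists_lift {U : Set (ℙ ℂ (Fin m → ℂ))}
    {φ : ℙ ℂ (Fin m → ℂ) → ℙ ℂ (Fin n → ℂ)} (hφ : HolomorphicOn U φ) (hU : IsOpen U)
    {v : Fin m → ℂ} (hv : v ≠ 0) (hvU : Projectivization.mk ℂ v hv ∈ U) :
    ∃ X f, v ∈ X ∧ IsLift U φ X f := by
  obtain ⟨N, f, hN, hvN, hf, h⟩ := hφ v hv hvU
  obtain ⟨ρ, hρ, hball⟩ := Metric.isOpen_iff.1 (hN.inter (isOpen_cone hU)) v ⟨hvN, hv, hvU⟩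
  refine ⟨Metric.ball v ρ, f, Metric.mem_ball_self hρ, Metric.isOpen_ball, convex_ball v ρ,
    hf.mono fun x hx => (hball hx).1, fun z hz => ?_⟩
  obtain ⟨h1, h2, h3⟩ := hball hz
  obtain ⟨hfz, h4⟩ := h z h1 h2
  exact ⟨h2, hfz, h3, h4⟩

/-- The identity theorem for homogeneous holomorphic conditions along a holomorphic map on a
connected open subset of projective space. -/
theorem IsLift.identity {U : Set (ℙ ℂ (Fin m → ℂ))} {φ : ℙ ℂ (Fin m → ℂ) → ℙ ℂ (Fin n → ℂ)}
    (hφ : HolomorphicOn U φ) (hUo : IsOpen U) (hU : IsPreconnected U) {X : Set (Fin m → ℂ)}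
    {f : (Fin m → ℂ) → (Fin n → ℂ)} (hX : IsLift U φ X f) {X' : Set (Fin m → ℂ)} (hX' : X' ⊆ X)
    (hX'o : IsOpen X') (hX'n : X'.Nonempty) (h : (Fin m → ℂ) → (Fin n → ℂ) → ℂ)
    (hd : Differentiable ℂ fun p : (Fin m → ℂ) × (Fin n → ℂ) => h p.1 p.2)
    (hh : ∀ (c d : ℂ) z y, h z y = 0 → h (c • z) (d • y) = 0)
    (h0 : ∀ z ∈ X', h z (f z) = 0) {p : ℙ ℂ (Fin m → ℂ)} (hp : p ∈ U) {z : Fin m → ℂ}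
    (hz : z ∈ p.submodule) {y : Fin n → ℂ} (hy : y ∈ (φ p).submodule) : h z y = 0 := by
  -- By homogeneity the condition does not depend on the lifts. The interior of `S` is relatively
  -- closed in `U`: a local lift at a limit point satisfies the condition on an open part of its
  -- convex domain, hence everywhere on it.
  let S : Set (ℙ ℂ (Fin m → ℂ)) :=
    {p | p ∈ U ∧ ∀ z ∈ p.submodule, ∀ y ∈ (φ p).submodule, h z y = 0}
  have hmk : ∀ {X f}, IsLift U φ X f → ∀ N ⊆ X, IsOpen N → (∀ z ∈ N, h z (f z) = 0) →
      ∀ v ∈ N, ∃ hv : v ≠ 0, Projectivization.mk ℂ v hv ∈ interior S := by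
    intro X f hX N hNX hN hN0 v hv
    refine ⟨(hX.lift v (hNX hv)).1, mem_interior.2 ⟨_, ?_, isOpen_image_mk hN,
      ⟨v, (hX.lift v (hNX hv)).1, hv, rfl⟩⟩⟩
    rintro _ ⟨x, hx, hxN, rfl⟩
    obtain ⟨_, hf, hxU, hφx⟩ := hX.lift x (hNX hxN)
    refine ⟨hxU, fun z hz y hy => ?_⟩
    rw [hφx] at hy
    rw [Projectivization.submodule_mk] at hz hy
    obtain ⟨c, rfl⟩ := Submodule.mem_span_singleton.1 hz
    obtain ⟨d, rfl⟩ := Submodule.mem_span_singleton.1 hy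
    exact hh c d _ _ (hN0 x hxN)
  have hsub : U ⊆ interior S := by
    refine hU.subset_of_closure_inter_subset isOpen_interior ?_ ?_
    · obtain ⟨v, hv⟩ := hX'n
      obtain ⟨hv0, h⟩ := hmk hX X' hX' hX'o h0 v hv
      exact ⟨_, (interior_subset h).1, h⟩
    · rintro p ⟨hpc, hpU⟩
      induction p using Projectivization.ind with | _ v hv
      obtain ⟨N, f', hvN, hN⟩ := hφ.exists_lift hUo hv hpU
      obtain ⟨_, ⟨v₁, hv₁, hv₁N, rfl⟩, hv₁S⟩ := mem_closure_iff.1 hpc _ (isOpen_image_mk hN.isOpen)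
        ⟨v, hv, hvN, rfl⟩
      have hg : DifferentiableOn ℂ (fun z => h z (f' z)) N :=
        hd.comp_differentiableOn (differentiableOn_id.prodMk hN.diff)
      have hz0 : ∀ z ∈ N, h z (f' z) = 0 := fun z hz => by
        refine eq_zero_of_eventually_eq_zero_on_subspace hN.isOpen hN.convex hg ⊤ hv₁N trivial ?_
          hz trivial
        filter_upwards [hN.isOpen.mem_nhds hv₁N,
          (isOpen_cone isOpen_interior).mem_nhds ⟨hv₁, hv₁S⟩] with x hx hxS _
        obtain ⟨hx0, hxS⟩ := hxS
        obtain ⟨_, hf, -, hφx⟩ := hN.lift x hx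
        refine (interior_subset hxS).2 x ?_ (f' x) ?_
        · rw [Projectivization.submodule_mk]
          exact Submodule.mem_span_singleton_self x
        · rw [hφx, Projectivization.submodule_mk]
          exact Submodule.mem_span_singleton_self _
      exact (hmk hN N subset_rfl hN.isOpen hz0 v hvN).2
  exact (interior_subset (hsub hp)).2 z hz y hy

end Identity

/-! ### Existence of admissible tuples -/

/-- Adding a fixed vector to small multiples of an independent family keeps it independent, with
at most one exceptional value of the multiplier. -/
theorem exists_linearIndependent_add_smul {M : Type*} [AddCommGroup M] [Module ℂ M] {k : ℕ}
    {b : Fin k → M} (hb : LinearIndependent ℂ b) (x : M) :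
    ∃ C : ℂ, ∀ η : ℂ, η ≠ 0 → η ≠ C → LinearIndependent ℂ (fun i => x + η • b i) := by
  have hsum : ∀ (γ : Fin k → ℂ) (η : ℂ), ∑ i, γ i • (x + η • b i) =
      (∑ i, γ i) • x + ∑ i, (η * γ i) • b i := fun γ η => by
    simp only [smul_add, Finset.sum_add_distrib, Finset.sum_smul, smul_smul, mul_comm]
  by_cases hx : ∃ β : Fin k → ℂ, x = ∑ i, β i • b i
  · obtain ⟨β, hβ⟩ := hx
    -- Summing the coefficients of a relation `γ` gives `(∑ γ) * (∑ β + η) = 0`, so only `η = -∑ β`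
    -- allows `∑ γ ≠ 0`.
    refine ⟨-∑ i, β i, fun η hη hηC => Fintype.linearIndependent_iff.2 fun γ hγ => ?_⟩
    rw [hsum, hβ, Finset.smul_sum, ← Finset.sum_add_distrib] at hγ
    simp only [smul_smul, ← add_smul] at hγ
    have h1 := Fintype.linearIndependent_iff.1 hb _ hγ
    have h2 : (∑ i, γ i) * (∑ i, β i + η) = 0 := by
      have : ∑ i, ((∑ i, γ i) * β i + η * γ i) = 0 := Finset.sum_eq_zero fun i _ => h1 i
      rw [Finset.sum_add_distrib, ← Finset.mul_sum, ← Finset.mul_sum] at this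
      linear_combination this
    have h3 : ∑ i, γ i = 0 := (mul_eq_zero.1 h2).resolve_right fun h => hηC (by
      linear_combination h)
    intro i
    have := h1 i
    rw [h3, zero_mul, zero_add] at this
    exact (mul_eq_zero.1 this).resolve_left hη
  · refine ⟨0, fun η hη _ => Fintype.linearIndependent_iff.2 fun γ hγ => ?_⟩
    rw [hsum] at hγ
    have h3 : ∑ i, γ i = 0 := by
      by_contra h
      refine hx ⟨fun i => -(∑ i, γ i)⁻¹ * (η * γ i), ?_⟩
      have : x = -(∑ i, γ i)⁻¹ • ∑ i, (η * γ i) • b i := by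
        rw [← eq_neg_of_add_eq_zero_left hγ |> fun h => neg_eq_iff_eq_neg.2 h]
        simp [smul_smul, h]
      rw [this, Finset.smul_sum]
      simp [smul_smul]
    rw [h3, zero_smul, zero_add] at hγ
    intro i
    exact (mul_eq_zero.1 (Fintype.linearIndependent_iff.1 hb _ hγ i)).resolve_left hη

namespace LocalPair

variable {Z W E : Type*} [NormedAddCommGroup Z] [NormedSpace ℂ Z]
    [NormedAddCommGroup W] [NormedSpace ℂ W] [NormedAddCommGroup E] [NormedSpace ℂ E]
    (D : LocalPair Z W E) {k : ℕ} [FiniteDimensional ℂ Z]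

theorem exists_mem_X_B_ne_zero
    (hker : Module.finrank ℂ (LinearMap.ker (D.B : Z →ₗ[ℂ] W →L[ℂ] ℂ)) + (k + 1) ≤
      Module.finrank ℂ Z) (hk : 0 < k) {z₀ : Z} (hz₀ : z₀ ∈ D.X) {w₀ : W} (h : D.B z₀ w₀ = 0) :
    ∃ z ∈ D.X, D.B z w₀ = 0 ∧ ∃ δ, D.B z δ ≠ 0 := by
  by_cases h0 : ∃ δ, D.B z₀ δ ≠ 0
  · exact ⟨z₀, hz₀, h, h0⟩
  push Not at h0
  obtain ⟨u, hu, δ, hδ⟩ := D.exists_B_ne_zero hker (fun _ : Fin k => w₀) (show 1 ≤ k from hk)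
  have hu0 : D.B u w₀ = 0 := hu ⟨0, hk⟩ zero_lt_one
  have hl : Continuous fun s : ℂ => z₀ + s • u := by fun_prop
  have h1 : ∀ᶠ s in 𝓝 (0 : ℂ), z₀ + s • u ∈ D.X :=
    hl.continuousAt.eventually (D.isOpen_X.mem_nhds (by simpa using hz₀))
  obtain ⟨s, h2, h3⟩ := ((h1.filter_mono nhdsWithin_le_nhds).and
    (self_mem_nhdsWithin : ∀ᶠ s in 𝓝[≠] (0 : ℂ), s ∈ ({0}ᶜ : Set ℂ))).exists
  have h3 : s ≠ 0 := h3
  exact ⟨_, h2, by simp [h, hu0], δ, by simp [h0 δ, hδ, h3]⟩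

/-- The vectors orthogonal to `z` have an image of dimension at least `k` modulo the kernel of the
form. The constant tuple `w₀` is perturbed by small multiples of independent such directions, which
keeps `z` in the common complement. -/
theorem dom_nonempty [FiniteDimensional ℂ W]
    (hker : Module.finrank ℂ (LinearMap.ker (D.B : Z →ₗ[ℂ] W →L[ℂ] ℂ)) + (k + 1) ≤
      Module.finrank ℂ Z)
    (hker' : Module.finrank ℂ (LinearMap.ker (D.B.flip : W →ₗ[ℂ] Z →L[ℂ] ℂ)) + (k + 1) ≤
      Module.finrank ℂ W) (hk : 0 < k) {z₀ : Z} (hz₀ : z₀ ∈ D.X) {w₀ : W} (hw₀ : w₀ ∈ D.Y)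
    (h : D.B z₀ w₀ = 0) : (D.dom k).Nonempty := by
  obtain ⟨z, hz, hzw, -⟩ := D.exists_mem_X_B_ne_zero hker hk hz₀ h
  let K : Submodule ℂ W := LinearMap.ker (D.B z : W →ₗ[ℂ] ℂ)
  let L : K →ₗ[ℂ] (Z →L[ℂ] ℂ) := (D.B.flip : W →ₗ[ℂ] Z →L[ℂ] ℂ) ∘ₗ K.subtype
  have hK : Module.finrank ℂ W ≤ Module.finrank ℂ K + 1 := by
    have h1 := LinearMap.finrank_range_add_finrank_ker (D.B z : W →ₗ[ℂ] ℂ)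
    have h2 := Submodule.finrank_le (LinearMap.range (D.B z : W →ₗ[ℂ] ℂ))
    rw [Module.finrank_self] at h2
    change _ + Module.finrank ℂ K = _ at h1
    omega
  obtain ⟨C, hC⟩ := (LinearMap.ker L).exists_isCompl
  have hCk : k ≤ Module.finrank ℂ C := by
    have h1 := Submodule.finrank_add_eq_of_isCompl hC
    have h2 : Module.finrank ℂ (LinearMap.ker L) ≤
        Module.finrank ℂ (LinearMap.ker (D.B.flip : W →ₗ[ℂ] Z →L[ℂ] ℂ)) := by
      rw [← Submodule.finrank_map_subtype_eq K (LinearMap.ker L)]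
      refine Submodule.finrank_mono ?_
      rintro _ ⟨x, hx, rfl⟩
      exact hx
    omega
  let e := Module.finBasis ℂ C
  let w' : Fin k → K := fun i => e (Fin.castLE hCk i)
  have hwli : LinearIndependent ℂ w' :=
    (e.linearIndependent.comp _ (Fin.castLE_injective hCk)).map' C.subtype C.ker_subtype
  have he : LinearIndependent ℂ fun i => D.B.flip (w' i : W) := by
    refine hwli.map (f := L) (hC.symm.disjoint.mono_left (Submodule.span_le.2 ?_))
    rintro _ ⟨i, rfl⟩
    exact (e (Fin.castLE hCk i)).2
  obtain ⟨c, hc⟩ := exists_linearIndependent_add_smul he (D.B.flip w₀)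
  have hY : ∀ᶠ s in 𝓝 (0 : ℂ), ∀ i, w₀ + s • (w' i : W) ∈ D.Y := Filter.eventually_all.2 fun i => by
    have hl : Continuous fun s : ℂ => w₀ + s • (w' i : W) := by fun_prop
    exact hl.continuousAt.eventually (D.isOpen_Y.mem_nhds (by simpa using hw₀))
  have hCs : ∀ᶠ s in 𝓝[≠] (0 : ℂ), s ≠ c := by
    by_cases hc0 : c = 0
    · rw [hc0]
      exact self_mem_nhdsWithin
    · exact (eventually_ne_nhds (Ne.symm hc0)).filter_mono nhdsWithin_le_nhds
  obtain ⟨s, ⟨h2, h3⟩, h4⟩ := (((hY.filter_mono nhdsWithin_le_nhds).and hCs).and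
    (self_mem_nhdsWithin : ∀ᶠ s in 𝓝[≠] (0 : ℂ), s ∈ ({0}ᶜ : Set ℂ))).exists
  refine ⟨fun i => w₀ + s • (w' i : W), h2, ?_, z, hz, fun i _ => ?_⟩
  · simpa using hc s h4 h3
  · have : D.B z (w' i) = 0 := (w' i).2
    simp [hzw, this]

end LocalPair

/-! ### From orthogonal pairs to local pairs -/

section Global

variable {r s t n : ℕ} {U : Set (PSpace r s t)} {φ ψ : PSpace r s t → PSpace n 0 0}

theorem IsLift.mem_submodule {φ : PSpace r s t → PSpace n 0 0} {X : Set (CSpace r s t)}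
    {f : CSpace r s t → CSpace n 0 0} (hX : IsLift U φ X f) {z : CSpace r s t} (hz : z ∈ X) :
    ∃ p ∈ U, z ∈ p.submodule ∧ f z ∈ (φ p).submodule := by
  obtain ⟨h1, h2, h3, h4⟩ := hX.lift z hz
  refine ⟨_, h3, ?_, ?_⟩
  · rw [Projectivization.submodule_mk]
    exact Submodule.mem_span_singleton_self z
  · rw [h4, Projectivization.submodule_mk]
    exact Submodule.mem_span_singleton_self _

theorem differentiable_herm_left (y : CSpace r s t) :
    Differentiable ℂ fun x : CSpace r s t => herm r s t x y := by
  simp only [herm_eq_bform]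
  fun_prop

/-- A vector orthogonal to the values of a lift on an open set is orthogonal to all values. -/
theorem IsLift.herm_eq_zero (hφ : HolomorphicOn U φ) (hUo : IsOpen U) (hU : IsPreconnected U)
    {X : Set (CSpace r s t)} {f : CSpace r s t → CSpace n 0 0} (hX : IsLift U φ X f)
    {X' : Set (CSpace r s t)} (hX' : X' ⊆ X) (hX'o : IsOpen X') (hX'n : X'.Nonempty)
    {e : CSpace n 0 0} (h0 : ∀ z ∈ X', herm n 0 0 (f z) e = 0) {p : PSpace r s t} (hp : p ∈ U)
    {y : CSpace n 0 0} (hy : y ∈ (φ p).submodule) : herm n 0 0 y e = 0 :=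
  hX.identity hφ hUo hU hX' hX'o hX'n (fun _ y => herm n 0 0 y e)
    ((differentiable_herm_left e).comp differentiable_snd)
    (fun c d z y h => (herm_smul_left d y e).trans (by rw [h, mul_zero])) h0 hp (Submodule.zero_mem _) hy

/-- The product is holomorphic in one variable and antiholomorphic in the other; exchanging the
arguments allows the identity theorem to be applied in each variable in turn. -/
theorem isNullPair_of_local (h : IsOrthogonalPair r s t n 0 0 U φ ψ) (hU : IsPreconnected U)
    {X Y X' Y' : Set (CSpace r s t)} {f g : CSpace r s t → CSpace n 0 0} (hX : IsLift U φ X f)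
    (hY : IsLift U ψ Y g) (hX' : X' ⊆ X) (hX'o : IsOpen X') (hX'n : X'.Nonempty)
    (hY' : Y' ⊆ Y) (hY'o : IsOpen Y') (hY'n : Y'.Nonempty)
    (h0 : ∀ z ∈ X', ∀ q ∈ Y', herm n 0 0 (f z) (g q) = 0) : IsNullPair r s t n 0 0 U φ ψ := by
  intro p hp q hq x hx y hy
  rw [herm_eq_zero_comm]
  refine hY.herm_eq_zero h.holomorphic_right h.isOpen hU hY' hY'o hY'n (fun q' hq' => ?_) hq hy
  rw [herm_eq_zero_comm]
  exact hX.herm_eq_zero h.holomorphic_left h.isOpen hU hX' hX'o hX'n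
    (fun z hz => h0 z hz q' hq') hp hx

/-- Local lifts of an orthogonal pair which is not null, as a `LocalPair`. The second variable is
conjugated. -/
noncomputable def localPair (h : IsOrthogonalPair r s t n 0 0 U φ ψ) (hU : IsPreconnected U)
    (hnull : ¬ IsNullPair r s t n 0 0 U φ ψ)
    {X Y : Set (CSpace r s t)} {f g : CSpace r s t → CSpace n 0 0} (hX : IsLift U φ X f)
    (hY : IsLift U ψ Y g) : LocalPair (CSpace r s t) (CSpace r s t) (CSpace n 0 0) where
  B := bform r s t
  X := X
  Y := star ⁻¹' Y
  isOpen_X := hX.isOpen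
  convex_X := hX.convex
  isOpen_Y := hY.isOpen.preimage continuous_star
  F := f
  G w := (bform n 0 0).flip ((star ∘ g ∘ star) w)
  diff_F := hX.diff
  diff_G := by
    refine (bform n 0 0).flip.differentiable.comp_differentiableOn fun w hw => ?_
    have h1 := (hY.diff.differentiableAt (hY.isOpen.mem_nhds hw)).star_star
    rw [star_star] at h1
    exact h1.differentiableWithinAt
  F_ne z hz := (hX.lift z hz).2.1
  orth z hz w hw hB := by
    obtain ⟨hz0, hf0, hzU, hφ⟩ := hX.lift z hz
    obtain ⟨hw0, hg0, hwU, hψ⟩ := hY.lift (star w) hw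
    have h1 := h.perp _ hzU _ hwU ((perp_mk hz0 hw0).2 (by rwa [herm_star]))
    rw [hφ, hψ, perp_mk, herm_eq_bform] at h1
    exact h1
  nonnull X' hX' hX'o hX'n Y' hY' hY'o hY'n := by
    by_contra! hcon
    refine hnull (isNullPair_of_local h hU hX hY hX' hX'o hX'n (Y' := star ⁻¹' Y') (fun q hq => ?_)
      (hY'o.preimage continuous_star) ?_ fun z hz q hq => ?_)
    · simpa using hY' hq
    · obtain ⟨w, hw⟩ := hY'n
      exact ⟨star w, by simpa using hw⟩
    · have := hcon z hz _ hq
      simpa [herm_eq_bform] using this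

/-- In the given range of dimensions, the Hermitian product of the lifts of an orthogonal pair which
is not null agrees with the form of the source up to a product of functions of one variable. -/
theorem exists_lift_factorization {n : ℕ} (hn : (n : ℤ) ≤ 2 * ((r : ℤ) + (s : ℤ)) - 3)
    {φ ψ : PSpace r s t → PSpace n 0 0}
    (h : IsOrthogonalPair r s t n 0 0 U φ ψ) (hU : IsPreconnected U)
    (hperp : ∃ p ∈ U, ∃ q ∈ U, Perp r s t p q) (hnull : ¬ IsNullPair r s t n 0 0 U φ ψ) :
    ∃ (X Y : Set (CSpace r s t)) (f g : CSpace r s t → CSpace n 0 0), IsLift U φ X f ∧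
      IsLift U ψ Y g ∧ ∃ X' ⊆ X, IsOpen X' ∧ X'.Nonempty ∧ ∃ Y' ⊆ Y, IsOpen Y' ∧ Y'.Nonempty ∧
      ∃ a b : CSpace r s t → ℂ, ∀ z ∈ X', ∀ q ∈ Y',
        herm n 0 0 (f z) (g q) = a z * b q * herm r s t z q := by
  obtain ⟨p, hp, q, hq, hpq⟩ := hperp
  induction p using Projectivization.ind with | _ v hv
  induction q using Projectivization.ind with | _ w hw
  obtain ⟨X, f, hvX, hX⟩ := h.holomorphic_left.exists_lift h.isOpen hv hp
  obtain ⟨Y, g, hwY, hY⟩ := h.holomorphic_right.exists_lift h.isOpen hw hq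
  let D := localPair h hU hnull hX hY
  -- With `k = r + s - 1` the hypothesis on `n` reads `n + 1 ≤ 2 * k`.
  obtain ⟨k, hk⟩ : ∃ k, r + s = k + 1 := ⟨r + s - 1, by omega⟩
  have hker : Module.finrank ℂ
      (LinearMap.ker (bform r s t : CSpace r s t →ₗ[ℂ] CSpace r s t →L[ℂ] ℂ)) + (k + 1) ≤
      Module.finrank ℂ (CSpace r s t) := by
    have := finrank_ker_bform (r := r) (s := s) (t := t)
    omega
  have hsymm : (bform r s t).flip = bform r s t := by
    ext x y
    simp only [ContinuousLinearMap.flip_apply, bform_apply]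
    exact Finset.sum_congr rfl fun i _ => by ring
  have hdom : (D.dom k).Nonempty := by
    refine D.dom_nonempty (z₀ := v) (w₀ := star w) hker ?_ (by omega) hvX ?_ ?_
    · change Module.finrank ℂ (LinearMap.ker ((bform r s t).flip : CSpace r s t →ₗ[ℂ]
        CSpace r s t →L[ℂ] ℂ)) + (k + 1) ≤ _
      rwa [hsymm]
    · change star (star w) ∈ Y
      rwa [star_star]
    · rw [perp_mk, herm_eq_bform] at hpq
      exact hpq
  obtain ⟨X', hX', hX'o, hX'n, Y', hY', hY'o, hY'n, a, b, hab⟩ := D.exists_factorization hker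
    (by rw [Module.finrank_fin_fun]; omega) hdom
  refine ⟨X, Y, f, g, hX, hY, X', hX', hX'o, hX'n, star ⁻¹' Y', fun q hq => ?_,
    hY'o.preimage continuous_star, ?_, a, fun q => b (star q), fun z hz q hq => ?_⟩
  · have : star (star q) ∈ Y := hY' hq
    rwa [star_star] at this
  · obtain ⟨y, hy⟩ := hY'n
    exact ⟨star y, by simpa using hy⟩
  · have h1 : bform n 0 0 (f z) (star (g (star (star q)))) =
        a z * b (star q) * bform r s t z (star q) := hab z hz (star q) hq
    rw [star_star] at h1
    rw [herm_eq_bform, herm_eq_bform, h1]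

end Global

/-! ### Orthogonal complements and the radicals of a pairing -/

section Complement

variable {n : ℕ}

/-- The orthogonal complement with respect to the definite form. -/
def perp (S : Submodule ℂ (CSpace n 0 0)) : Submodule ℂ (CSpace n 0 0) where
  carrier := {x | ∀ y ∈ S, herm n 0 0 x y = 0}
  add_mem' := fun {a b} ha hb y hy => by rw [herm_add_left, ha y hy, hb y hy, add_zero]
  zero_mem' := fun y _ => herm_zero_left y
  smul_mem' := fun c a ha y hy => by rw [herm_smul_left, ha y hy, mul_zero]

/-- Definiteness of the target form enters here: the statement is transported from `EuclideanSpace`.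
-/
theorem isCompl_perp (S : Submodule ℂ (CSpace n 0 0)) : IsCompl (perp S) S := by
  let e : CSpace n 0 0 ≃ₗ[ℂ] EuclideanSpace ℂ (Fin (n + 0 + 0)) :=
    (WithLp.linearEquiv 2 ℂ (CSpace n 0 0)).symm
  have h := (Submodule.orderIsoMapComap e).symm.isCompl (Submodule.isCompl_orthogonal
    (K := S.map (e : CSpace n 0 0 →ₗ[ℂ] EuclideanSpace ℂ (Fin (n + 0 + 0))))).symm
  have h1 : (Submodule.orderIsoMapComap e).symm
      (S.map (e : CSpace n 0 0 →ₗ[ℂ] EuclideanSpace ℂ (Fin (n + 0 + 0))))ᗮ = perp S := by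
    ext x
    change e x ∈ (S.map (e : CSpace n 0 0 →ₗ[ℂ] EuclideanSpace ℂ (Fin (n + 0 + 0))))ᗮ ↔ _
    rw [Submodule.mem_orthogonal]
    constructor
    · intro hx y hy
      rw [herm_definite_eq_inner]
      exact hx _ ⟨y, hy, rfl⟩
    · rintro hx _ ⟨y, hy, rfl⟩
      rw [← hx y hy, herm_definite_eq_inner]
      rfl
  have h2 : (Submodule.orderIsoMapComap e).symm
      (S.map (e : CSpace n 0 0 →ₗ[ℂ] EuclideanSpace ℂ (Fin (n + 0 + 0)))) = S :=
    (Submodule.orderIsoMapComap e).symm_apply_apply S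
  rwa [h1, h2] at h

variable {P Q W : Submodule ℂ (CSpace n 0 0)}

theorem sub_projection_mem {V : Submodule ℂ (CSpace n 0 0)} (hVW : IsCompl V W)
    (x : CSpace n 0 0) : x - V.projection W hVW x ∈ W := by
  rw [← Submodule.projection_apply_eq_zero_iff hVW, map_sub,
    Submodule.projection_apply_of_mem_left hVW (Submodule.projection_apply_mem hVW x), sub_self]

/-- A vector of `P` is projected along the radicals of the pairing of `P` and `Q` by subtracting
an element of `P ∩ Q^⊥`. -/
theorem sub_projection_mem_radical (hW : W = P ⊓ perp Q ⊔ Q ⊓ perp P) {x : CSpace n 0 0}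
    (hx : x ∈ P) : x - (perp W).projection W (isCompl_perp W) x ∈ P ⊓ perp Q := by
  have hmem := sub_projection_mem (isCompl_perp W) x
  obtain ⟨p, hp, q, hq, hpq⟩ := Submodule.mem_sup.1 (hW.le hmem)
  have hqW : q ∈ W := hW.ge (Submodule.mem_sup_right hq)
  have hT := Submodule.projection_apply_mem (isCompl_perp W) x q hqW
  have hxq : herm n 0 0 x q = 0 := herm_eq_zero_comm.1 (hq.2 x hx)
  have hpq' : herm n 0 0 p q = 0 := herm_eq_zero_comm.1 (hq.2 p hp.1)
  -- `q` is orthogonal to `x`, to `p` and to the projection of `x`, hence to `q = x - T x - p`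
  -- itself.
  have hq0 : q = 0 := by
    refine eq_zero_of_herm_self ?_
    have : herm n 0 0 (p + q) q = 0 := by rw [hpq, herm_sub_left, hxq, hT, sub_zero]
    rwa [herm_add_left, hpq', zero_add] at this
  rw [← hpq, hq0, add_zero p]
  exact hp

theorem projection_mem (hW : W = P ⊓ perp Q ⊔ Q ⊓ perp P) {x : CSpace n 0 0}
    (hx : x ∈ P) : (perp W).projection W (isCompl_perp W) x ∈ P := by
  have := P.sub_mem hx (sub_projection_mem_radical hW hx).1
  rwa [sub_sub_cancel] at this

theorem herm_projection_left (hW : W = P ⊓ perp Q ⊔ Q ⊓ perp P) {x y : CSpace n 0 0}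
    (hx : x ∈ P) (hy : y ∈ Q) :
    herm n 0 0 ((perp W).projection W (isCompl_perp W) x) y = herm n 0 0 x y := by
  have := (sub_projection_mem_radical hW hx).2 y hy
  rw [herm_sub_left] at this
  exact (sub_eq_zero.1 this).symm

/-- Such a projection lies both in `P ∩ Q^⊥`, a part of `W`, and in `W^⊥`. It follows that the
projection of `P` is separated by pairing with `Q`. -/
theorem projection_eq_zero (hW : W = P ⊓ perp Q ⊔ Q ⊓ perp P) {x : CSpace n 0 0} (hx : x ∈ P)
    (h0 : ∀ y ∈ Q, herm n 0 0 ((perp W).projection W (isCompl_perp W) x) y = 0) :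
    (perp W).projection W (isCompl_perp W) x = 0 := by
  refine eq_zero_of_herm_self (Submodule.projection_apply_mem (isCompl_perp W) x _
    (hW.ge (Submodule.mem_sup_left ⟨projection_mem hW hx, h0⟩)))

end Complement

/-! ### Linearity of the projected maps and conclusion -/

/-- A map which becomes, after an injective linear map `J`, a scalar multiple of a linear map is
itself a scalar multiple of a linear map. -/
theorem exists_linearMap_lift {Z M N : Type*} [AddCommGroup Z] [Module ℂ Z] [AddCommGroup M]
    [Module ℂ M] [AddCommGroup N] [Module ℂ N] (J : M →ₗ[ℂ] N) (hJ : Function.Injective J)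
    (L : Z →ₗ[ℂ] N) {S : Set Z} (F : S → M) (a : Z → ℂ) (hF : ∀ z : S, J (F z) = a z • L z)
    (hS : ∀ K : Submodule ℂ Z, (∀ z ∈ S, a z ≠ 0 → z ∈ K) → K = ⊤) :
    ∃ Φ : Z →ₗ[ℂ] M, (∀ z, J (Φ z) = L z) ∧ ∀ z : S, F z = a z • Φ z := by
  have htop : (LinearMap.range J).comap L = ⊤ := hS _ fun z hz ha =>
    ⟨(a z)⁻¹ • F ⟨z, hz⟩, by rw [map_smul, hF ⟨z, hz⟩, inv_smul_smul₀ ha]⟩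
  have hL : ∀ z, L z ∈ LinearMap.range J := fun z => by
    have : z ∈ (LinearMap.range J).comap L := htop ▸ trivial
    exact this
  have hΦ : ∀ z, J (((LinearEquiv.ofInjective J hJ).symm ∘ₗ
      L.codRestrict (LinearMap.range J) hL) z) = L z := fun z =>
    congrArg Subtype.val ((LinearEquiv.ofInjective J hJ).apply_symm_apply
      (L.codRestrict (LinearMap.range J) hL z))
  exact ⟨_, hΦ, fun z => hJ (by rw [map_smul, hΦ, hF])⟩

section Global

variable {r s t n : ℕ} {U : Set (PSpace r s t)} {φ ψ : PSpace r s t → PSpace n 0 0}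

/-- The span of the values of a map into projective space. -/
noncomputable def valueSpan (U : Set (PSpace r s t)) (φ : PSpace r s t → PSpace n 0 0) :
    Submodule ℂ (CSpace n 0 0) :=
  ⨆ p ∈ U, (φ p).submodule

theorem le_valueSpan {p : PSpace r s t} (hp : p ∈ U) : (φ p).submodule ≤ valueSpan U φ :=
  le_biSup (fun p => (φ p).submodule) hp

theorem IsLift.mem_valueSpan {X : Set (CSpace r s t)} {f : CSpace r s t → CSpace n 0 0}
    (hX : IsLift U φ X f) {z : CSpace r s t} (hz : z ∈ X) : f z ∈ valueSpan U φ := by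
  obtain ⟨p, hp, -, hf⟩ := hX.mem_submodule hz
  exact le_valueSpan hp hf

/-- A vector orthogonal to the values of a lift on an open set is orthogonal to all values. -/
theorem IsLift.mem_perp_valueSpan (hφ : HolomorphicOn U φ) (hUo : IsOpen U)
    (hU : IsPreconnected U) {X X' : Set (CSpace r s t)} {f : CSpace r s t → CSpace n 0 0}
    (hX : IsLift U φ X f) (hX' : X' ⊆ X) (hX'o : IsOpen X') (hX'n : X'.Nonempty)
    {e : CSpace n 0 0} (h0 : ∀ z ∈ X', herm n 0 0 e (f z) = 0) : e ∈ perp (valueSpan U φ) := by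
  have hle : valueSpan U φ ≤ perp (Submodule.span ℂ {e}) := by
    refine iSup₂_le fun p hp y hy u hu => ?_
    obtain ⟨c, rfl⟩ := Submodule.mem_span_singleton.1 hu
    rw [herm_smul_right, hX.herm_eq_zero hφ hUo hU hX' hX'o hX'n
      (fun z hz => herm_eq_zero_comm.1 (h0 z hz)) hp hy, mul_zero]
  exact fun y hy => herm_eq_zero_comm.1 (hle hy e (Submodule.mem_span_singleton_self e))

theorem eq_top_of_isOpen_subset {S : Submodule ℂ (CSpace r s t)} {N : Set (CSpace r s t)}
    (hN : IsOpen N) (hNn : N.Nonempty) (h : ∀ z ∈ N, z ∈ S) : S = ⊤ := by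
  obtain ⟨x, hx⟩ := hNn
  exact S.eq_top_of_nonempty_interior' ⟨x, mem_interior.2 ⟨N, h, hN, hx⟩⟩

variable {X Y X' Y' : Set (CSpace r s t)} {f g : CSpace r s t → CSpace n 0 0}

/-- Near a point where the Hermitian product with `e` does not vanish, it does not vanish. -/
theorem IsLift.isOpen_herm_ne_zero {φ : PSpace r s t → PSpace n 0 0} (hX : IsLift U φ X f)
    (hX' : X' ⊆ X) (hX'o : IsOpen X') (e : CSpace n 0 0) :
    IsOpen (X' ∩ {z | herm n 0 0 (f z) e ≠ 0}) := by
  have hc : ContinuousOn (fun z => herm n 0 0 (f z) e) X' :=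
    (differentiable_herm_left e).continuous.comp_continuousOn (hX.diff.continuousOn.mono hX')
  exact hc.isOpen_inter_preimage hX'o isOpen_compl_singleton

/-- If the Hermitian product of the lifts factors through the form of the source, the projection of
one of them to the complement of the radicals is linear up to a scalar function. -/
theorem exists_linear_of_factorization (hψ : HolomorphicOn U ψ) (hUo : IsOpen U)
    (hU : IsPreconnected U) (hX : IsLift U φ X f) (hY : IsLift U ψ Y g) (hX' : X' ⊆ X)
    (hX'o : IsOpen X') (hY' : Y' ⊆ Y) (hY'o : IsOpen Y') (hY'n : Y'.Nonempty)
    {W : Submodule ℂ (CSpace n 0 0)}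
    (hW : W = valueSpan U φ ⊓ perp (valueSpan U ψ) ⊔ valueSpan U ψ ⊓ perp (valueSpan U φ))
    {a b : CSpace r s t → ℂ}
    (hab : ∀ z ∈ X', ∀ q ∈ Y', herm n 0 0 (f z) (g q) = a z * b q * herm r s t z q)
    (hne : ∃ z ∈ X', ∃ q ∈ Y', herm n 0 0 (f z) (g q) ≠ 0) :
    ∃ Φ : CSpace r s t →ₗ[ℂ] CSpace n 0 0,
      (∀ z ∈ X', (perp W).projection W (isCompl_perp W) (f z) = a z • Φ z) ∧
      (∀ z, ∀ q ∈ Y', herm n 0 0 (Φ z) (g q) = b q * herm r s t z q) ∧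
      ∀ z, Φ z ∈ valueSpan U φ ∧ Φ z ∈ perp W := by
  set T := (perp W).projection W (isCompl_perp W) with hT
  let P₁ : Submodule ℂ (CSpace n 0 0) := (valueSpan U φ).map T
  obtain ⟨J₀, hJ₀⟩ : ∃ J₀ : CSpace n 0 0 →ₗ[ℂ] (Y' → ℂ), ∀ e q, J₀ e q = herm n 0 0 e (g q) :=
    ⟨LinearMap.pi fun q => ((bform n 0 0).flip (star (g q)) : CSpace n 0 0 →ₗ[ℂ] ℂ),
      fun e q => (herm_eq_bform e (g q)).symm⟩
  obtain ⟨L, hLa⟩ : ∃ L : CSpace r s t →ₗ[ℂ] (Y' → ℂ), ∀ z q, L z q = b q * herm r s t z q :=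
    ⟨LinearMap.pi fun q => b q • ((bform r s t).flip (star (q : CSpace r s t)) :
      CSpace r s t →ₗ[ℂ] ℂ), fun z q => congrArg (b q * ·) (herm_eq_bform z q).symm⟩
  obtain ⟨J, hJa⟩ : ∃ J : P₁ →ₗ[ℂ] (Y' → ℂ), ∀ e q, J e q = herm n 0 0 e (g q) :=
    ⟨J₀ ∘ₗ P₁.subtype, fun e q => hJ₀ e q⟩
  -- `J` records the products with all `g q`, and `J (T (f z)) = a z • L z` by the factorization;
  -- injectivity of `J` then pulls the linear map `L` back to `Φ`.
  have hJinj : Function.Injective J := by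
    rw [← LinearMap.ker_eq_bot, LinearMap.ker_eq_bot']
    rintro ⟨e, he⟩ h0
    have h1 : ∀ q ∈ Y', herm n 0 0 e (g q) = 0 := fun q hq => by
      rw [← hJa ⟨e, he⟩ ⟨q, hq⟩, h0]
      rfl
    obtain ⟨x, hx, rfl⟩ := he
    exact Subtype.ext (projection_eq_zero hW hx
      (hY.mem_perp_valueSpan hψ hUo hU hY' hY'o hY'n h1))
  obtain ⟨z₁, hz₁, q₁, hq₁, hne⟩ := hne
  obtain ⟨Φ, hΦ, hΦF⟩ := exists_linearMap_lift J hJinj L (S := X')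
    (fun z => ⟨T (f z), f z, hX.mem_valueSpan (hX' z.2), rfl⟩) a (fun z => by
      funext q
      rw [hJa, Pi.smul_apply, hLa, smul_eq_mul, herm_projection_left hW
        (hX.mem_valueSpan (hX' z.2)) (hY.mem_valueSpan (hY' q.2)), hab z z.2 q q.2, mul_assoc])
    (fun K hK => eq_top_of_isOpen_subset (hX.isOpen_herm_ne_zero hX' hX'o (g q₁)) ⟨z₁, hz₁, hne⟩
      fun z hz => hK z hz.1 fun h => hz.2 (by rw [hab z hz.1 q₁ hq₁, h]; ring))
  refine ⟨P₁.subtype ∘ₗ Φ, fun z hz => congrArg Subtype.val (hΦF ⟨z, hz⟩), fun z q hq => ?_,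
    fun z => ?_⟩
  · have := congrFun (hΦ z) ⟨q, hq⟩
    rw [hJa, hLa] at this
    exact this
  · obtain ⟨x, hx, hxe⟩ := (Φ z).2
    change (Φ z : CSpace n 0 0) ∈ _ ∧ (Φ z : CSpace n 0 0) ∈ _
    rw [← hxe]
    exact ⟨projection_mem hW hx, Submodule.projection_apply_mem _ x⟩

/-- If a linear projection of a lift is locally a linear map up to a scalar function, the projected
map agrees with the map induced by the linear map. -/
theorem ratEqOn_of_local (hφ : HolomorphicOn U φ) (hUo : IsOpen U)
    (hU : IsPreconnected U) (hX : IsLift U φ X f) (hX' : X' ⊆ X)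
    (hX'o : IsOpen X') (T : CSpace n 0 0 →ₗ[ℂ] CSpace n 0 0)
    (Φ : CSpace r s t →ₗ[ℂ] CSpace n 0 0) {a : CSpace r s t → ℂ}
    (h : ∀ z ∈ X', T (f z) = a z • Φ z) (hne : ∃ z ∈ X', T (f z) ≠ 0) :
    RatEqOn U (compLinear T (lineMap φ)) (ofLinear Φ) := by
  have hX'n : X'.Nonempty := hne.imp fun z hz => hz.1
  have hTd : ∀ i, Differentiable ℂ fun p : CSpace r s t × CSpace n 0 0 => T p.2 i := fun i =>
    (((ContinuousLinearMap.proj (R := ℂ) (φ := fun _ => ℂ) i) ∘L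
      LinearMap.toContinuousLinearMap T).differentiable).comp differentiable_snd
  have hΦd : ∀ i, Differentiable ℂ fun p : CSpace r s t × CSpace n 0 0 => Φ p.1 i := fun i =>
    (((ContinuousLinearMap.proj (R := ℂ) (φ := fun _ => ℂ) i) ∘L
      LinearMap.toContinuousLinearMap Φ).differentiable).comp differentiable_fst
  constructor
  · intro p hp
    by_contra hcl
    obtain ⟨O, hO, hOo, hpO⟩ : ∃ O, O ⊆ {p | p ∈ U ∧ compLinear T (lineMap φ) p ≠ ⊥ ∧
        ofLinear Φ p ≠ ⊥}ᶜ ∧ IsOpen O ∧ p ∈ O :=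
      mem_nhds_iff.1 (isClosed_closure.isOpen_compl.mem_nhds hcl |> fun h =>
        Filter.mem_of_superset h (Set.compl_subset_compl.2 subset_closure))
    induction p using Projectivization.ind with | _ v hv
    obtain ⟨N, f', hvN, hN⟩ := hφ.exists_lift hUo hv hp
    -- If density failed near `p`, all products of a coordinate of `T y` and one of `Φ z` would
    -- vanish near `p`, hence on `U`, although `T ∘ f` and `Φ` are both nonzero at some point of
    -- `X'`.
    have hzero : ∀ i j, ∀ p ∈ U, ∀ z ∈ p.submodule, ∀ y ∈ (φ p).submodule, T y i * Φ z j = 0 := by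
      intro i j p hp z hz y hy
      refine hN.identity hφ hUo hU (X' := N ∩ {v | ∃ hv : v ≠ 0, Projectivization.mk ℂ v hv ∈ O})
        Set.inter_subset_left (hN.isOpen.inter (isOpen_cone hOo)) ⟨v, hvN, hv, hpO⟩
        (fun z y => T y i * Φ z j) ((hTd i).mul (hΦd j)) (fun c d z y h => ?_) ?_ hp hz hy
      · simp only [map_smul, Pi.smul_apply, smul_eq_mul]
        linear_combination c * d * h
      · rintro z ⟨hzN, hz0, hzO⟩
        obtain ⟨_, hfz, hzU, hφz⟩ := hN.lift z hzN
        by_cases hT0 : T (f' z) = 0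
        · simp [hT0]
        by_cases hΦ0 : Φ z = 0
        · simp [hΦ0]
        refine absurd ⟨hzU, ?_, ?_⟩ (hO hzO)
        · refine fun hb => hT0 ((Submodule.mem_bot ℂ).1 (hb ▸ ⟨f' z, ?_, rfl⟩))
          rw [lineMap, hφz, Projectivization.submodule_mk]
          exact Submodule.mem_span_singleton_self _
        · refine fun hb => hΦ0 ((Submodule.mem_bot ℂ).1 (hb ▸ ⟨z, ?_, rfl⟩))
          rw [lineMap, id, Projectivization.submodule_mk]
          exact Submodule.mem_span_singleton_self _
    obtain ⟨z, hz, hTz⟩ := hne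
    obtain ⟨q, hq, hzq, hfq⟩ := hX.mem_submodule (hX' hz)
    obtain ⟨i, hi⟩ := Function.ne_iff.1 hTz
    have := hzero i i q hq z hzq _ hfq
    have h1 := congrFun (h z hz) i
    rw [Pi.smul_apply, smul_eq_mul] at h1
    rcases mul_eq_zero.1 this with h2 | h2
    · exact hi h2
    · exact hi (by rw [h1, h2, mul_zero]; rfl)
  · intro p hp
    -- Proportionality of `T y` and `Φ z` is expressed by the `2 × 2` minors, to which the identity
    -- theorem applies.
    have hprop : ∀ i j, ∀ z ∈ p.submodule, ∀ y ∈ (φ p).submodule,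
        T y i * Φ z j - T y j * Φ z i = 0 := by
      intro i j z hz y hy
      refine hX.identity hφ hUo hU hX' hX'o hX'n (fun z y => T y i * Φ z j - T y j * Φ z i)
        (((hTd i).mul (hΦd j)).sub ((hTd j).mul (hΦd i))) (fun c d z y h => ?_) (fun z hz => ?_)
        hp hz hy
      · simp only [map_smul, Pi.smul_apply, smul_eq_mul]
        linear_combination c * d * h
      · rw [h z hz]
        simp only [Pi.smul_apply, smul_eq_mul]
        ring
    induction p using Projectivization.ind with | _ v hv
    obtain ⟨y, hy, hφy⟩ : ∃ (y : CSpace n 0 0) (hy : y ≠ 0),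
        φ (Projectivization.mk ℂ v hv) = Projectivization.mk ℂ y hy :=
      ⟨_, Projectivization.rep_nonzero _, (Projectivization.mk_rep _).symm⟩
    simp only [compLinear, ofLinear, lineMap, id, hφy, Projectivization.submodule_mk,
      Submodule.map_span, Set.image_singleton] at hprop ⊢
    intro h1 h2
    have hprop' := fun i j => hprop i j v (Submodule.mem_span_singleton_self v) y
      (Submodule.mem_span_singleton_self y)
    rw [ne_eq, Submodule.span_singleton_eq_bot] at h1 h2
    obtain ⟨j, hj⟩ := Function.ne_iff.1 h2
    have hj : Φ v j ≠ 0 := hj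
    have hTy : T y = (T y j / Φ v j) • Φ v := by
      funext i
      have := hprop' i j
      rw [Pi.smul_apply, smul_eq_mul]
      field_simp
      linear_combination this
    have hc : T y j / Φ v j ≠ 0 := fun h => h1 (by rw [hTy, h, zero_smul])
    rw [hTy]
    exact Submodule.span_singleton_smul_eq (IsUnit.mk0 _ hc) _

/-- The decomposition is `W^⊥ ⊕ W`, with `W` the sum of the two radicals of the pairing of `P` and
`Q`. The scalar functions are absorbed in the lifts, so the linear pair is conformal with constant
`1`. -/
theorem isQuasiStandard_of_factorization (h : IsOrthogonalPair r s t n 0 0 U φ ψ)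
    (hU : IsPreconnected U) (hX : IsLift U φ X f) (hY : IsLift U ψ Y g) (hX' : X' ⊆ X)
    (hX'o : IsOpen X') (hX'n : X'.Nonempty) (hY' : Y' ⊆ Y) (hY'o : IsOpen Y') (hY'n : Y'.Nonempty)
    {a b : CSpace r s t → ℂ}
    (hab : ∀ z ∈ X', ∀ q ∈ Y', herm n 0 0 (f z) (g q) = a z * b q * herm r s t z q)
    (hne : ∃ z ∈ X', ∃ q ∈ Y', herm n 0 0 (f z) (g q) ≠ 0) :
    IsQuasiStandard r s t n 0 0 U φ ψ := by
  set P := valueSpan U φ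
  set Q := valueSpan U ψ
  set W := P ⊓ perp Q ⊔ Q ⊓ perp P with hW
  have hW' : W = Q ⊓ perp P ⊔ P ⊓ perp Q := by rw [hW, sup_comm]
  set T := (perp W).projection W (isCompl_perp W)
  have hba : ∀ q ∈ Y', ∀ z ∈ X', herm n 0 0 (g q) (f z) =
      conj (b q) * conj (a z) * herm r s t q z := fun q hq z hz => by
    rw [← conj_herm, hab z hz q hq, map_mul, map_mul, conj_herm]
    ring
  obtain ⟨Φ, hΦ1, hΦ2, hΦ3⟩ := exists_linear_of_factorization h.holomorphic_right h.isOpen hU hX hY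
    hX' hX'o hY' hY'o hY'n hW hab hne
  obtain ⟨z₁, hz₁, q₁, hq₁, hne⟩ := hne
  obtain ⟨Ψ, hΨ1, hΨ2, hΨ3⟩ := exists_linear_of_factorization h.holomorphic_left h.isOpen hU hY hX
    hY' hY'o hX' hX'o hX'n hW' hba ⟨q₁, hq₁, z₁, hz₁, fun h => hne (herm_eq_zero_comm.1 h)⟩
  have hTP : ∀ x ∈ P, ∀ y ∈ Q, herm n 0 0 (T x) y = herm n 0 0 x y := fun x hx y hy =>
    herm_projection_left hW hx hy
  have hTQ : ∀ x ∈ P, ∀ y ∈ Q, herm n 0 0 x (T y) = herm n 0 0 x y := fun x hx y hy => by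
    rw [← conj_herm, herm_projection_left hW' hy hx, conj_herm]
  -- Both sides are compared through the product of `Φ z` with `g q`, cancelling `b q`; the `q` with
  -- `b q ≠ 0` contain a nonempty open set, whose span is everything.
  have hconf : ∀ z q, herm n 0 0 (Φ z) (Ψ q) = herm r s t z q := by
    let S : Submodule ℂ (CSpace r s t) :=
      { carrier := {q | ∀ z, herm n 0 0 (Φ z) (Ψ q) = herm r s t z q}
        add_mem' := fun {x y} hx hy z => by
          rw [map_add, herm_add_right, herm_add_right, hx, hy]
        zero_mem' := fun z => by rw [map_zero, herm_zero_right, herm_zero_right]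
        smul_mem' := fun c x hx z => by rw [map_smul, herm_smul_right, herm_smul_right, hx] }
    have hS : S = ⊤ := by
      refine eq_top_of_isOpen_subset (hY.isOpen_herm_ne_zero hY' hY'o (f z₁))
        ⟨q₁, hq₁, fun h => hne (herm_eq_zero_comm.1 h)⟩ ?_
      rintro q ⟨hq, hqne⟩ z
      have hb : b q ≠ 0 := fun h => hqne (by rw [hba q hq z₁ hz₁, h, map_zero]; ring)
      have h1 := hTQ (Φ z) (hΦ3 z).1 (g q) (hY.mem_valueSpan (hY' hq))
      rw [hΨ1 q hq, herm_smul_right, Complex.conj_conj, hΦ2 z q hq] at h1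
      exact mul_left_cancel₀ hb h1
    intro z q
    have : q ∈ S := hS ▸ trivial
    exact this z
  have hTf : T (f z₁) ≠ 0 := fun h0 => hne (by
    rw [← hTP _ (hX.mem_valueSpan (hX' hz₁)) _ (hY.mem_valueSpan (hY' hq₁)), h0, herm_zero_left])
  have hTg : T (g q₁) ≠ 0 := fun h0 => hne (by
    rw [← hTQ _ (hX.mem_valueSpan (hX' hz₁)) _ (hY.mem_valueSpan (hY' hq₁)), h0, herm_zero_right])
  refine ⟨perp W, W, isCompl_perp W, fun x hx y hy => hx y hy, ⟨Φ, Ψ, ⟨1, one_ne_zero, fun z w => ?_⟩,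
    ratEqOn_of_local h.holomorphic_left h.isOpen hU hX hX' hX'o T Φ hΦ1 ⟨z₁, hz₁, hTf⟩,
    ratEqOn_of_local h.holomorphic_right h.isOpen hU hY hY' hY'o T Ψ hΨ1 ⟨q₁, hq₁, hTg⟩⟩,
    Or.inr ?_⟩
  · rw [hconf, Complex.ofReal_one, one_mul]
  · have hproj : ∀ x, W.projection (perp W) (isCompl_perp W).symm x = x - T x := fun x =>
      eq_sub_of_add_eq' (Submodule.projection_add_projection_eq_self (isCompl_perp W) x)
    -- The two `W`-components lie in `P ∩ Q^⊥` and in `Q ∩ P^⊥`.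
    rintro p hp q hq _ ⟨x, hx, rfl⟩ _ ⟨y, hy, rfl⟩
    rw [hproj, hproj]
    exact (sub_projection_mem_radical hW (le_valueSpan hp hx)).2 _
      (sub_projection_mem_radical hW' (le_valueSpan hq hy)).1

end Global

end OrthogonalPair

open OrthogonalPair in
theorem theorem1p4 (r s t n' : ℕ) (hn : (n' : ℤ) ≤ 2 * ((r : ℤ) + (s : ℤ)) - 3)
    (U : Set (PSpace r s t)) (hU : IsConnected U)
    (hperp : ∃ p ∈ U, ∃ q ∈ U, Perp r s t p q)
    (φ ψ : PSpace r s t → PSpace n' 0 0)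
    (h : IsOrthogonalPair r s t n' 0 0 U φ ψ) :
    IsQuasiStandard r s t n' 0 0 U φ ψ ∨ IsNullPair r s t n' 0 0 U φ ψ := by
  by_cases hnull : IsNullPair r s t n' 0 0 U φ ψ
  · exact Or.inr hnull
  left
  obtain ⟨X, Y, f, g, hX, hY, X', hX', hX'o, hX'n, Y', hY', hY'o, hY'n, a, b, hab⟩ :=
    exists_lift_factorization hn h hU.isPreconnected hperp hnull
  refine isQuasiStandard_of_factorization h hU.isPreconnected hX hY hX' hX'o hX'n hY' hY'o hY'n
    hab ?_
  by_contra! hcon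
  exact hnull (isNullPair_of_local h hU.isPreconnected hX hY hX' hX'o hX'n hY' hY'o hY'n hcon)
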